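/- Let $d,k\ge 2$ be integers, let $\sigma$ be the standard surface measure on the unit sphere $\mathbb S^{d-1}\subset\mathbb R^d$, and for $f\in L^1(\mathbb S^{d-1})$ (complex-valued) put $\widehat{f\sigma}(\xi)=\int_{\mathbb S^{d-1}}e^{-i\zeta\cdot\xi}f(\zeta)\,d\sigma(\zeta)$, $\xi\in\mathbb R^d$. Let $\sigma^{(k)}$ denote the $k$-fold convolution $\sigma*\dots*\sigma$, identified with its Radon--Nikodym derivative with respect to Lebesgue measure on $\mathbb R^d$. Let $f_1,\dots,f_k\in L^1(\mathbb S^{d-1})$ be nonzero (that is, none of them vanishes $\sigma$-a.e.). Then, as an inequality in $[0,\infty]$, $$\Big\|\prod_{j=1}^k\widehat{f_j\sigma}\Big\|_{L^2(\mathbb R^d)}^2\le(2\pi)^d\int_{(\mathbb S^{d-1})^k}\sigma^{(k)}(\zeta_1+\dots+\zeta_k)\prod_{j=1}^k|f_j(\zeta_j)|^2\,d\sigma(\zeta_1)\cdots d\sigma(\zeta_k).$$ Moreover, if $(d,k)\ne(2,2)$ and the right-hand side is finite, then equality holds if and only if there exist $c_1,\dots,c_k\in\mathbb C\setminus\{0\}$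 and a single $\nu\in\mathbb C^d$ such that, for every $j=1,\dots,k$, $f_j(\zeta)=c_je^{\nu\cdot\zeta}$ for $\sigma$-a.e. $\zeta\in\mathbb S^{d-1}$, where $\nu\cdot\zeta=\sum_{i=1}^d\nu_i\zeta_i$. -/

import Mathlib

open MeasureTheory
open scoped ENNReal

noncomputable section

namespace SphereRestriction

/-- The unit sphere `𝕊^{d-1}` of `ℝ^d` (with the Euclidean norm). -/
abbrev Sph (d : ℕ) : Type := Metric.sphere (0 : EuclideanSpace ℝ (Fin d)) 1

/-- The standard surface measure on `𝕊^{d-1}`, of total mass `d` times the volume of the unit ball. -/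
abbrev surf (d : ℕ) : Measure (Sph d) :=
  (volume : Measure (EuclideanSpace ℝ (Fin d))).toSphere

/-- The Fourier transform `ξ ↦ ∫ e^{-i ζ·ξ} f(ζ) dσ(ζ)` of the measure `f σ`. -/
def fourierSurf {d : ℕ} (f : Sph d → ℂ) (ξ : EuclideanSpace ℝ (Fin d)) : ℂ :=
  ∫ ζ, Complex.exp (-Complex.I * (inner ℝ (ζ : EuclideanSpace ℝ (Fin d)) ξ : ℝ)) * f ζ ∂(surf d)

/-- The `k`-fold convolution `σ * ⋯ * σ`, as a Borel measure on `ℝ^d`: the measure of `E` is the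
`σ^k`-measure of the set of `(ζ_1, …, ζ_k)` with `ζ_1 + ⋯ + ζ_k ∈ E`. -/
def surfConv (d k : ℕ) : Measure (EuclideanSpace ℝ (Fin d)) :=
  (Measure.pi fun _ : Fin k => surf d).map fun ζ => ∑ j, (ζ j : EuclideanSpace ℝ (Fin d))

/-- The density (Radon-Nikodym derivative) of the `k`-fold convolution of the surface measure with
respect to Lebesgue measure on `ℝ^d`. -/
def surfConvDensity (d k : ℕ) : EuclideanSpace ℝ (Fin d) → ℝ≥0∞ :=
  (surfConv d k).rnDeriv volume

/-- The right-hand side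
`(2π)^d ∫ σ^{(k)}(ζ_1 + ⋯ + ζ_k) ∏ |f_j(ζ_j)|² dσ(ζ_1) ⋯ dσ(ζ_k)`, with values in `[0, ∞]`. -/
def weightedIntegral {d k : ℕ} (f : Fin k → Sph d → ℂ) : ℝ≥0∞ :=
  ENNReal.ofReal ((2 * Real.pi) ^ d) *
    ∫⁻ ζ : Fin k → Sph d,
      surfConvDensity d k (∑ j, (ζ j : EuclideanSpace ℝ (Fin d))) * ∏ j, ‖f j (ζ j)‖ₑ ^ 2
      ∂(Measure.pi fun _ : Fin k => surf d)

/-- The left-hand side `‖∏ \hat{f_j σ}‖²` in `L²(ℝ^d)`, with values in `[0, ∞]`. -/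
def prodNormSq {d k : ℕ} (f : Fin k → Sph d → ℂ) : ℝ≥0∞ :=
  eLpNorm (fun ξ : EuclideanSpace ℝ (Fin d) => ∏ j, fourierSurf (f j) ξ) 2 volume ^ 2

end SphereRestriction

end

/-! ### Plancherel's identity on `L¹ ∩ L²` -/

open MeasureTheory
open scoped ENNReal

/-! Put `P = σ^k` on the product of spheres, `X = ζ_1 + ⋯ + ζ_k` and `G = ∏ f_j(ζ_j)`. By Fubini the
product of the transforms is the transform of the push-forward of `G P` under `X`. The law of `X`
has a density `ρ = σ^{(k)}`, so this push-forward has density `ρ h` with `h ∘ X = E[G | X]`, and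
Plancherel gives `(2π)^d ‖E[√ρ(X) G | X]‖²`. Conditional expectation contracts `L²`, which is the
inequality; equality means that `√ρ(X) G`, hence `G`, is a function of `X`
(`eLpNorm_fourier_pushforward_le_and_eq_iff`). Absolute continuity of the law comes from radial
symmetry (`surfConv_absolutelyContinuous`).

It remains to solve `∏ f_j(ζ_j) = h(ζ_1 + ⋯ + ζ_k)` for merely integrable `f_j`. Such a product is
orthogonal to every `Ψ` whose push-forward under `X` vanishes (`sum_prod_integral_eq_zero`).
Swapping two exponentials in `Ψ` shows that the `f_j` are proportional. Rotational derivatives of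
exponentials give quadratic identities (`coordMoment_bilinear`), or cubic ones when `d = 2`
(`coordMoment_trilinear`), between the moments `M(z) = ∫ f_0 a e^{z·a}` and `N_{jl}(z) = z_l M_j -
z_j M_l`. As the `M(z)` span `ℂ^d`, linear algebra forces `N_{jl} = κ_l M_j - κ_j M_l` for a fixed
`κ`. Then `f_0 e^{κ·a}` has a radial Fourier transform, so it is constant
(`ae_eq_const_of_rotation`). -/

theorem eLpNorm_two_sq_eq_lintegral {Ω : Type*} [MeasurableSpace Ω] {P : Measure Ω} (g : Ω → ℂ) :
    eLpNorm g 2 P ^ 2 = ∫⁻ x, ‖g x‖ₑ ^ 2 ∂P := by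
  simpa using eLpNorm_nnreal_pow_eq_lintegral (f := g) (μ := P) (p := 2) (by norm_num)

open scoped FourierTransform SchwartzMap ContDiff in
/-- Plancherel's identity for functions in `L¹ ∩ L²`. -/
theorem eLpNorm_fourier_eq_of_integrable_of_memLp {E : Type*} [NormedAddCommGroup E]
    [InnerProductSpace ℝ E] [FiniteDimensional ℝ E] [MeasurableSpace E] [BorelSpace E]
    {F : E → ℂ} (h1 : Integrable F) (h2 : MemLp F 2) :
    eLpNorm (𝓕 F) 2 volume = eLpNorm F 2 volume := by
  set u : Lp ℂ 2 (volume : Measure E) := h2.toLp F with hu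
  have hcont : Continuous (𝓕 F) :=
    VectorFourier.fourierIntegral_continuous Real.continuous_fourierChar
      (by exact continuous_inner) h1
  -- The `L²` transform is defined abstractly; it is identified with the integral by testing against
  -- smooth compactly supported functions and moving the transform onto them.
  have hae : ((𝓕 u : Lp ℂ 2 (volume : Measure E)) : E → ℂ) =ᵐ[volume] 𝓕 F := by
    apply ae_eq_of_integral_contDiff_smul_eq
    · exact (Lp.memLp _).locallyIntegrable (by norm_num)
    · exact hcont.locallyIntegrable
    intro g hg hgc
    have hgC : ContDiff ℝ ∞ (fun x => (g x : ℂ)) := Complex.ofRealCLM.contDiff.comp hg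
    have hgcC : HasCompactSupport (fun x => (g x : ℂ)) := hgc.comp_left (g :=
      fun t : ℝ => (t : ℂ)) rfl
    set φ : 𝓢(E, ℂ) := hgcC.toSchwartzMap hgC with hφ
    have key := congrArg (fun T : 𝓢'(E, ℂ) => T φ) (Lp.fourier_toTemperedDistribution_eq u)
    simp only [TemperedDistribution.fourier_apply, Lp.toTemperedDistribution_apply] at key
    have e1 : ∫ x, g x • ((𝓕 u : Lp ℂ 2 (volume : Measure E)) : E → ℂ) x
        = ∫ x, φ x • ((𝓕 u : Lp ℂ 2 (volume : Measure E)) : E → ℂ) x := by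
      congr 1
    rw [e1, ← key]
    have e2 : ∫ x, (𝓕 φ) x • (u : E → ℂ) x = ∫ x, (𝓕 φ) x • F x := by
      apply integral_congr_ae
      filter_upwards [h2.coeFn_toLp] with x hx
      rw [hu, hx]
    rw [e2]
    have := VectorFourier.integral_fourierIntegral_smul_eq_flip (L := innerₗ E) (μ := volume)
      (ν := volume) Real.continuous_fourierChar (by exact continuous_inner) φ.integrable h1
    rw [flip_innerₗ] at this
    exact this
  rw [← eLpNorm_congr_ae hae, ← eLpNorm_congr_ae h2.coeFn_toLp]
  have := Lp.norm_fourier_eq u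
  rw [Lp.norm_def, Lp.norm_def] at this
  exact (ENNReal.toReal_eq_toReal_iff' (Lp.eLpNorm_ne_top _) (Lp.eLpNorm_ne_top _)).1 this

open scoped FourierTransform in
/-- Plancherel's identity with the normalization `ξ ↦ ∫ e^{-i x·ξ} F(x) dx`. -/
theorem eLpNorm_sq_integral_exp_neg_inner {d : ℕ} {F : EuclideanSpace ℝ (Fin d) → ℂ}
    (h1 : Integrable F) (h2 : MemLp F 2) :
    eLpNorm (fun ξ : EuclideanSpace ℝ (Fin d) =>
      ∫ x, Complex.exp (-Complex.I * (inner ℝ x ξ : ℝ)) * F x) 2 volume ^ 2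
      = ENNReal.ofReal ((2 * Real.pi) ^ d) * eLpNorm F 2 volume ^ 2 := by
  have hpi : (0 : ℝ) < 2 * Real.pi := by positivity
  have hF : (fun ξ : EuclideanSpace ℝ (Fin d) =>
      ∫ x, Complex.exp (-Complex.I * (inner ℝ x ξ : ℝ)) * F x)
      = fun ξ => 𝓕 F ((2 * Real.pi)⁻¹ • ξ) := by
    ext ξ
    rw [Real.fourier_eq']
    congr 1
    ext x
    rw [smul_eq_mul, inner_smul_right]
    congr 2
    push_cast
    field_simp
  rw [hF, ← eLpNorm_fourier_eq_of_integrable_of_memLp h1 h2, eLpNorm_two_sq_eq_lintegral,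
    eLpNorm_two_sq_eq_lintegral]
  have hcont : Continuous (𝓕 F) :=
    VectorFourier.fourierIntegral_continuous Real.continuous_fourierChar
      (by exact continuous_inner) h1
  have hmap := Measure.map_addHaar_smul (volume : Measure (EuclideanSpace ℝ (Fin d)))
    (inv_ne_zero hpi.ne')
  have hl : ∫⁻ x, ‖𝓕 F ((2 * Real.pi)⁻¹ • x)‖ₑ ^ 2
      = ∫⁻ y, ‖𝓕 F y‖ₑ ^ 2 ∂(Measure.map ((2 * Real.pi)⁻¹ • ·) volume) := by
    rw [lintegral_map (by fun_prop) (by fun_prop)]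
  rw [hl, hmap, lintegral_smul_measure, smul_eq_mul]
  congr 2
  rw [finrank_euclideanSpace_fin, inv_pow, inv_inv, abs_of_pos (by positivity)]

/-! ### Fourier uniqueness for push-forwards of densities -/

section CharFun

variable {Ω E : Type*} [MeasurableSpace Ω] {P : Measure Ω} [NormedAddCommGroup E]
  [InnerProductSpace ℝ E] [FiniteDimensional ℝ E] [MeasurableSpace E] [BorelSpace E]

theorem integrable_mul_exp_inner_mul_I {u : Ω → ℂ} (hu : Integrable u P) {X : Ω → E}
    (hX : Measurable X) (ξ : E) :
    Integrable (fun ω => u ω * Complex.exp ((inner ℝ (X ω) ξ : ℝ) * Complex.I)) P := by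
  refine hu.mul_bdd (c := 1) ?_ (Filter.Eventually.of_forall fun ω => ?_)
  · exact (by fun_prop : Measurable fun ω =>
      Complex.exp ((inner ℝ (X ω) ξ : ℝ) * Complex.I)).aestronglyMeasurable
  · rw [Complex.norm_exp_ofReal_mul_I]

theorem charFun_map_withDensity_ofReal {v : Ω → ℝ} (hv : AEMeasurable v P) (h0 : ∀ ω, 0 ≤ v ω)
    {X : Ω → E} (hX : Measurable X) (ξ : E) :
    charFun ((P.withDensity fun ω => ENNReal.ofReal (v ω)).map X) ξ
      = ∫ ω, (v ω : ℂ) * Complex.exp ((inner ℝ (X ω) ξ : ℝ) * Complex.I) ∂P := by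
  rw [charFun_apply, integral_map hX.aemeasurable (by fun_prop)]
  have : (fun ω => ENNReal.ofReal (v ω)) = fun ω => ((v ω).toNNReal : ℝ≥0∞) := rfl
  rw [this, integral_withDensity_eq_integral_smul₀ hv.real_toNNReal]
  congr 1
  ext ω
  rw [NNReal.smul_def, Real.coe_toNNReal _ (h0 ω), Complex.real_smul]

/-- A real density whose push-forward under `X` has vanishing Fourier transform has
vanishing push-forward. -/
theorem setIntegral_preimage_eq_zero_of_charFun_real {v : Ω → ℝ} (hv : Integrable v P) {X : Ω → E}
    (hX : Measurable X)
    (h : ∀ ξ : E, ∫ ω, (v ω : ℂ) * Complex.exp ((inner ℝ (X ω) ξ : ℝ) * Complex.I) ∂P = 0)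
    {B : Set E} (hB : MeasurableSet B) : ∫ ω in X ⁻¹' B, v ω ∂P = 0 := by
  have hp : Integrable (fun ω => max (v ω) 0) P := hv.pos_part
  have hn : Integrable (fun ω => max (-v ω) 0) P := hv.neg_part
  have fin : ∀ w : Ω → ℝ, Integrable w P →
      IsFiniteMeasure (P.withDensity fun ω => ENNReal.ofReal (w ω)) := fun w hw =>
    isFiniteMeasure_withDensity_ofReal hw.2
  have hp' : Integrable (fun ω => ((max (v ω) 0 : ℝ) : ℂ)) P := hp.ofReal
  have hn' : Integrable (fun ω => ((max (-v ω) 0 : ℝ) : ℂ)) P := hn.ofReal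
  have := fin _ hp
  have := fin _ hn
  -- The positive and negative parts push forward to finite measures with the same characteristic
  -- function, hence to the same measure.
  have key : (P.withDensity fun ω => ENNReal.ofReal (max (v ω) 0)).map X
      = (P.withDensity fun ω => ENNReal.ofReal (max (-v ω) 0)).map X := by
    apply Measure.ext_of_charFun
    ext ξ
    rw [charFun_map_withDensity_ofReal hp.1.aemeasurable (fun _ => le_max_right _ _) hX,
      charFun_map_withDensity_ofReal hn.1.aemeasurable (fun _ => le_max_right _ _) hX,
      ← sub_eq_zero, ← integral_sub (integrable_mul_exp_inner_mul_I hp' hX ξ)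
        (integrable_mul_exp_inner_mul_I hn' hX ξ), ← h ξ]
    congr 1
    ext ω
    rw [← sub_mul, ← Complex.ofReal_sub]
    congr 2
    rcases le_total 0 (v ω) with h | h
    · rw [max_eq_left h, max_eq_right (by linarith), sub_zero]
    · rw [max_eq_right h, max_eq_left (by linarith)]; ring
  have hBeq := congrArg (fun μ => μ B) key
  rw [Measure.map_apply hX hB, Measure.map_apply hX hB, withDensity_apply _ (hX hB),
    withDensity_apply _ (hX hB)] at hBeq
  rw [integral_eq_lintegral_pos_part_sub_lintegral_neg_part hv.integrableOn]
  have e : ∀ t : ℝ, ENNReal.ofReal (max t 0) = ENNReal.ofReal t := fun t => by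
    rcases le_total 0 t with h | h <;> simp [h, ENNReal.ofReal_of_nonpos]
  simp only [e] at hBeq
  rw [hBeq, sub_self]

/-- A complex density whose push-forward under `X` has vanishing Fourier transform has
vanishing push-forward. -/
theorem setIntegral_preimage_eq_zero_of_charFun {u : Ω → ℂ} (hu : Integrable u P) {X : Ω → E}
    (hX : Measurable X)
    (h : ∀ ξ : E, ∫ ω, u ω * Complex.exp ((inner ℝ (X ω) ξ : ℝ) * Complex.I) ∂P = 0)
    {B : Set E} (hB : MeasurableSet B) : ∫ ω in X ⁻¹' B, u ω ∂P = 0 := by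
  -- Conjugating the hypothesis at `-ξ` gives it for the conjugate density, so the real and
  -- imaginary parts can be treated separately.
  have hc : ∀ ξ : E, ∫ ω, (starRingEnd ℂ) (u ω) *
      Complex.exp ((inner ℝ (X ω) ξ : ℝ) * Complex.I) ∂P = 0 := by
    intro ξ
    have := congrArg (starRingEnd ℂ) (h (-ξ))
    rw [← integral_conj, map_zero] at this
    rw [← this]
    congr 1
    ext ω
    rw [map_mul, ← Complex.exp_conj]
    simp
  have hcu : Integrable (fun ω => (starRingEnd ℂ) (u ω)) P :=
    (Complex.conjCLE.toContinuousLinearMap.integrable_comp hu :)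
  have hre : ∀ ξ : E, ∫ ω, ((u ω).re : ℂ) *
      Complex.exp ((inner ℝ (X ω) ξ : ℝ) * Complex.I) ∂P = 0 := by
    intro ξ
    have := congrArg₂ (fun a b : ℂ => (1 / 2) * (a + b)) (h ξ) (hc ξ)
    rw [← integral_add (integrable_mul_exp_inner_mul_I hu hX ξ)
      (integrable_mul_exp_inner_mul_I hcu hX ξ), ← integral_const_mul] at this
    simp only [add_zero, mul_zero] at this
    rw [← this]
    congr 1
    ext ω
    rw [Complex.re_eq_add_conj]
    ring
  have him : ∀ ξ : E, ∫ ω, ((u ω).im : ℂ) *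
      Complex.exp ((inner ℝ (X ω) ξ : ℝ) * Complex.I) ∂P = 0 := by
    intro ξ
    have := congrArg₂ (fun a b : ℂ => (1 / (2 * Complex.I)) * (a - b)) (h ξ) (hc ξ)
    rw [← integral_sub (integrable_mul_exp_inner_mul_I hu hX ξ)
      (integrable_mul_exp_inner_mul_I hcu hX ξ), ← integral_const_mul] at this
    simp only [sub_zero, mul_zero] at this
    rw [← this]
    congr 1
    ext ω
    rw [Complex.im_eq_sub_conj]
    field_simp
  have h1 := setIntegral_preimage_eq_zero_of_charFun_real hu.re hX hre hB
  have h2 := setIntegral_preimage_eq_zero_of_charFun_real hu.im hX him hB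
  rw [← integral_re_add_im hu.integrableOn]
  rw [h1, h2]
  simp

/-- Fourier uniqueness along an embedding. -/
theorem ae_eq_zero_of_charFun {u : Ω → ℂ}
    (hu : Integrable u P) {X : Ω → E} (hX : MeasurableEmbedding X)
    (h : ∀ ξ : E, ∫ ω, u ω * Complex.exp ((inner ℝ (X ω) ξ : ℝ) * Complex.I) ∂P = 0) :
    u =ᵐ[P] 0 := by
  apply hu.ae_eq_zero_of_forall_setIntegral_eq_zero
  intro s hs _
  have := setIntegral_preimage_eq_zero_of_charFun hu hX.measurable h (hX.measurableSet_image.2 hs)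
  rwa [Set.preimage_image_eq _ hX.injective] at this

/-- If the push-forward of `Ψ P` under `X` has vanishing Fourier transform, then `Ψ` is orthogonal
to the functions of `X`. -/
theorem integral_mul_eq_zero_of_charFun [IsFiniteMeasure P] {Ψ G : Ω → ℂ} (hΨ : Integrable Ψ P)
    {X : Ω → E} (hX : Measurable X)
    (h : ∀ ξ : E, ∫ ω, Ψ ω * Complex.exp ((inner ℝ (X ω) ξ : ℝ) * Complex.I) ∂P = 0)
    (hG : AEStronglyMeasurable[MeasurableSpace.comap X inferInstance] G P)
    (hGΨ : Integrable (fun ω => G ω * Ψ ω) P) :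
    ∫ ω, G ω * Ψ ω ∂P = 0 := by
  have hm : MeasurableSpace.comap X inferInstance ≤ (inferInstance : MeasurableSpace Ω) :=
    hX.comap_le
  -- The sets `X⁻¹(B)` are all the events of `σ(X)`, so `E[Ψ | X] = 0`; then `G` is pulled out of
  -- the conditional expectation.
  have h0 : (0 : Ω → ℂ) =ᵐ[P] P[Ψ | MeasurableSpace.comap X inferInstance] := by
    refine ae_eq_condExp_of_forall_setIntegral_eq hm hΨ
      (fun s _ _ => integrableOn_zero) ?_ aestronglyMeasurable_zero
    rintro s ⟨B, hB, rfl⟩ _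
    rw [setIntegral_preimage_eq_zero_of_charFun hΨ hX h hB]
    simp
  have h1 := condExp_bilin_of_aestronglyMeasurable_left (ContinuousLinearMap.mul ℝ ℂ) hG hGΨ hΨ
  rw [← integral_condExp hm]
  have h2 : P[fun ω => G ω * Ψ ω | MeasurableSpace.comap X inferInstance] =ᵐ[P] 0 := by
    filter_upwards [h0, h1] with ω a b
    refine Eq.trans b ?_
    rw [← a]
    simp
  rw [integral_congr_ae h2]
  simp

end CharFun

/-! ### Rotation invariance of `σ` and absolute continuity of its convolutions -/

namespace SphereRestriction

open scoped Pointwise in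
/-- The surface measure, seen on the ambient space, is invariant under linear isometries. -/
theorem map_surf_linearIsometryEquiv {d : ℕ}
    (R : EuclideanSpace ℝ (Fin d) ≃ₗᵢ[ℝ] EuclideanSpace ℝ (Fin d)) :
    ((surf d).map Subtype.val).map R = (surf d).map Subtype.val := by
  have hv : Measurable (Subtype.val : Sph d → EuclideanSpace ℝ (Fin d)) := measurable_subtype_coe
  have hR : Measurable R := R.continuous.measurable
  ext s hs
  rw [Measure.map_apply hR hs, Measure.map_apply hv (hR hs), Measure.map_apply hv hs,
    Measure.toSphere_apply' _ (hv (hR hs)), Measure.toSphere_apply' _ (hv hs)]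
  congr 1
  have : Set.Ioo (0 : ℝ) 1 • (Subtype.val '' (Subtype.val ⁻¹' (R ⁻¹' s) : Set (Sph d)))
      = R ⁻¹' (Set.Ioo (0 : ℝ) 1 • (Subtype.val '' (Subtype.val ⁻¹' s : Set (Sph d)))) := by
    ext x
    simp only [Set.mem_smul, Set.mem_preimage, Set.mem_image, Subtype.exists,
      mem_sphere_zero_iff_norm]
    constructor
    · rintro ⟨t, ht, _, ⟨a, ha, has, rfl⟩, rfl⟩
      exact ⟨t, ht, R a, ⟨R a, by simpa using ha, has, rfl⟩, by simp⟩
    · rintro ⟨t, ht, _, ⟨a, ha, has, rfl⟩, hx⟩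
      refine ⟨t, ht, R.symm a, ⟨R.symm a, by simpa using ha, by simpa using has, rfl⟩, ?_⟩
      apply R.injective
      simp [← hx]
  rw [this]
  exact R.measurePreserving.measure_preimage_equiv (f := R.toMeasurableEquiv) _

instance (d : ℕ) : IsFiniteMeasure ((surf d).map Subtype.val) :=
  Measure.isFiniteMeasure_map _ _

theorem charFun_map_linearIsometryEquiv {E : Type*} [NormedAddCommGroup E]
    [InnerProductSpace ℝ E] [MeasurableSpace E] [BorelSpace E] (μ : Measure E) (R : E ≃ₗᵢ[ℝ] E)
    (ξ : E) : charFun (μ.map R) (R ξ) = charFun μ ξ := by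
  rw [charFun_apply, charFun_apply]
  refine (R.toHomeomorph.measurableEmbedding.integral_map (μ := μ) _).trans ?_
  simp

/-- The reflection in the hyperplane orthogonal to `ξ - η` carries `ξ` to `η` and preserves `σ`. -/
theorem charFun_surf_eq_of_norm_eq {d : ℕ} {ξ η : EuclideanSpace ℝ (Fin d)} (h : ‖ξ‖ = ‖η‖) :
    charFun ((surf d).map Subtype.val) ξ = charFun ((surf d).map Subtype.val) η := by
  have := charFun_map_linearIsometryEquiv ((surf d).map Subtype.val)
    ((Submodule.span ℝ {ξ - η})ᗮ.reflection) ξ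
  rw [Submodule.reflection_sub h, map_surf_linearIsometryEquiv] at this
  exact this.symm

/-- A finite measure with radial Fourier transform is an average of surface measures. -/
theorem smul_eq_map_prod_surf_of_charFun_radial {d : ℕ} (μ : Measure (EuclideanSpace ℝ (Fin d)))
    [IsFiniteMeasure μ] (hμ : ∀ ξ η, ‖ξ‖ = ‖η‖ → charFun μ ξ = charFun μ η) :
    (surf d Set.univ) • μ
      = (μ.prod (surf d)).map fun p => ‖p.1‖ • (p.2 : EuclideanSpace ℝ (Fin d)) := by
  have hfin : IsFiniteMeasure ((surf d Set.univ) • μ) := Measure.smul_finite _ (measure_ne_top _ _)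
  have hmeas : Measurable fun p : EuclideanSpace ℝ (Fin d) × Sph d =>
    ‖p.1‖ • (p.2 : EuclideanSpace ℝ (Fin d)) := by fun_prop
  have hfin2 : IsFiniteMeasure ((μ.prod (surf d)).map fun p : EuclideanSpace ℝ (Fin d) × Sph d =>
    ‖p.1‖ • (p.2 : EuclideanSpace ℝ (Fin d))) := Measure.isFiniteMeasure_map _ _
  apply Measure.ext_of_charFun
  ext ξ
  have hint : ∀ φ : EuclideanSpace ℝ (Fin d) × Sph d → ℝ, Measurable φ →
      Integrable (fun p => Complex.exp (φ p * Complex.I)) (μ.prod (surf d)) := by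
    intro φ hφ
    refine (integrable_const (1 : ℝ)).mono' ?_ (Filter.Eventually.of_forall fun p => ?_)
    · exact (by fun_prop : Measurable fun p => Complex.exp (φ p * Complex.I)).aestronglyMeasurable
    · rw [Complex.norm_exp_ofReal_mul_I]
  have hσ : ∀ η, charFun ((surf d).map Subtype.val) η
      = ∫ ω : Sph d, Complex.exp ((inner ℝ (ω : EuclideanSpace ℝ (Fin d)) η : ℝ) * Complex.I)
          ∂(surf d) := by
    intro η
    rw [charFun_apply, integral_map (by fun_prop) (by fun_prop)]
  rw [charFun_apply (μ := Measure.map _ _), integral_map hmeas.aemeasurable (by fun_prop),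
    integral_prod _ (hint _ (by fun_prop))]
  -- Both integrals are the radial transform of `σ` at radius `‖x‖‖ξ‖`. The second form is the one
  -- that can be integrated in `x`, giving the transform of `μ` at `‖ξ‖ω`.
  have e1 : ∀ x : EuclideanSpace ℝ (Fin d),
      ∫ ω : Sph d, Complex.exp ((inner ℝ (‖x‖ • (ω : EuclideanSpace ℝ (Fin d))) ξ : ℝ) * Complex.I)
        ∂(surf d)
      = ∫ ω : Sph d, Complex.exp ((inner ℝ x (‖ξ‖ • (ω : EuclideanSpace ℝ (Fin d))) : ℝ)
        * Complex.I) ∂(surf d) := by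
    intro x
    have : charFun ((surf d).map Subtype.val) (‖x‖ • ξ)
        = charFun ((surf d).map Subtype.val) (‖ξ‖ • x) :=
      charFun_surf_eq_of_norm_eq (by simp [norm_smul, mul_comm])
    rw [hσ, hσ] at this
    simp only [real_inner_smul_left, real_inner_smul_right] at this ⊢
    rw [this]
    congr 1
    ext ω
    rw [real_inner_comm]
  simp only [e1]
  rw [integral_integral_swap (hint _ (by fun_prop))]
  have e2 : ∀ ω : Sph d, ∫ x, Complex.exp ((inner ℝ x (‖ξ‖ • (ω : EuclideanSpace ℝ (Fin d))) : ℝ)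
        * Complex.I) ∂μ = charFun μ ξ := by
    intro ω
    rw [← charFun_apply]
    exact hμ _ _ (by simp [norm_smul])
  simp only [e2]
  rw [integral_const, charFun_apply, integral_smul_measure, charFun_apply]
  rfl

/-- Almost every sphere centred at the origin meets a null set in a null set. -/
theorem ae_surf_smul_preimage_eq_zero {d : ℕ} {N : Set (EuclideanSpace ℝ (Fin d))}
    (hN : MeasurableSet N) (h0 : volume N = 0) :
    ∀ᵐ r : ℝ, 0 < r → surf d {ω | r • (ω : EuclideanSpace ℝ (Fin d)) ∈ N} = 0 := by
  have hmp := Measure.measurePreserving_homeomorphUnitSphereProd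
    (volume : Measure (EuclideanSpace ℝ (Fin d)))
  set A : Set (Sph d × Set.Ioi (0 : ℝ)) := {p | (p.2 : ℝ) • (p.1 : EuclideanSpace ℝ (Fin d)) ∈ N}
  have hA : MeasurableSet A := by
    have : Measurable fun p : Sph d × Set.Ioi (0 : ℝ) =>
      (p.2 : ℝ) • (p.1 : EuclideanSpace ℝ (Fin d)) := by fun_prop
    exact this hN
  have h1 : ((surf d).prod (Measure.volumeIoiPow
      (Module.finrank ℝ (EuclideanSpace ℝ (Fin d)) - 1))) A = 0 := by
    rw [← hmp.measure_preimage hA.nullMeasurableSet]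
    have : (homeomorphUnitSphereProd (EuclideanSpace ℝ (Fin d))) ⁻¹' A = Subtype.val ⁻¹' N := by
      ext x
      have hx : ‖(x : EuclideanSpace ℝ (Fin d))‖ ≠ 0 := norm_ne_zero_iff.2 x.2
      simp [A, smul_smul, hx]
    rw [this, comap_subtype_coe_apply (measurableSet_singleton _).compl]
    exact measure_mono_null (Set.image_preimage_subset _ _) h0
  rw [Measure.prod_apply_symm hA, lintegral_eq_zero_iff (measurable_measure_prodMk_right hA),
    Measure.volumeIoiPow] at h1
  have h2 : ∀ᵐ r : Set.Ioi (0 : ℝ) ∂(Measure.comap Subtype.val volume),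
      surf d {ω | (r : ℝ) • (ω : EuclideanSpace ℝ (Fin d)) ∈ N} = 0 := by
    -- The radial weight `r^(d-1)` of polar coordinates is positive on `(0, ∞)`, so its null sets
    -- there are Lebesgue null.
    filter_upwards [(ae_withDensity_iff (by fun_prop)).1 h1] with r hr
    refine hr ?_
    have : 0 < (r : ℝ) := r.2
    simpa using pow_pos this _
  rw [← ae_restrict_iff_subtype measurableSet_Ioi
    (p := fun r : ℝ => surf d {ω | r • (ω : EuclideanSpace ℝ (Fin d)) ∈ N} = 0),
    ae_restrict_iff' measurableSet_Ioi] at h2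
  exact h2

/-- A finite measure with radial Fourier transform is absolutely continuous as soon as the
distribution of the norm is. -/
theorem absolutelyContinuous_of_charFun_radial {d : ℕ} (hd : d ≠ 0)
    (μ : Measure (EuclideanSpace ℝ (Fin d)))
    [IsFiniteMeasure μ] (hμ : ∀ ξ η, ‖ξ‖ = ‖η‖ → charFun μ ξ = charFun μ η)
    (hn : μ.map norm ≪ volume) : μ ≪ volume := by
  refine Measure.AbsolutelyContinuous.mk fun N hN h0 => ?_
  have hA := ae_surf_smul_preimage_eq_zero hN h0
  have h00 : ∀ᵐ r : ℝ, r ≠ 0 := by simp [ae_iff, measure_singleton]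
  have hA' := ae_of_ae_map measurable_norm.aemeasurable (hn.ae_le (hA.and h00))
  have hm : Measurable fun p : EuclideanSpace ℝ (Fin d) × Sph d =>
    ‖p.1‖ • (p.2 : EuclideanSpace ℝ (Fin d)) := by fun_prop
  have key := congrArg (fun ν => ν N) (smul_eq_map_prod_surf_of_charFun_radial μ hμ)
  simp only [Measure.smul_apply, smul_eq_mul] at key
  rw [Measure.map_apply hm hN, Measure.prod_apply (hm hN)] at key
  have hz : ∫⁻ x, surf d (Prod.mk x ⁻¹' ((fun p : EuclideanSpace ℝ (Fin d) × Sph d =>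
      ‖p.1‖ • (p.2 : EuclideanSpace ℝ (Fin d))) ⁻¹' N)) ∂μ = 0 := by
    rw [lintegral_eq_zero_iff (measurable_measure_prodMk_left (hm hN))]
    filter_upwards [hA'] with x hx
    exact hx.1 ((norm_nonneg x).lt_of_ne' hx.2)
  rw [hz] at key
  refine (mul_eq_zero.1 key).resolve_left ?_
  have : Nonempty (Fin d) := ⟨⟨0, Nat.pos_of_ne_zero hd⟩⟩
  exact Measure.measure_univ_ne_zero.2 (Measure.toSphere_ne_zero _)

/-- For a unit vector `a` of `ℝ^d`, `d ≥ 2`, the distribution of `ω ↦ ‖a + ω‖` under the surface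
measure is absolutely continuous. -/
theorem surf_norm_add_mem_null {d : ℕ} (hd : 2 ≤ d) {a : EuclideanSpace ℝ (Fin d)}
    (ha : ‖a‖ = 1) {M : Set ℝ} (hM : MeasurableSet M) (h0 : volume M = 0) :
    surf d {ω | ‖a + (ω : EuclideanSpace ℝ (Fin d))‖ ∈ M} = 0 := by
  have hms : MeasurableSet {ω : Sph d | ‖a + (ω : EuclideanSpace ℝ (Fin d))‖ ∈ M} := by
    have : Measurable fun ω : Sph d => ‖a + (ω : EuclideanSpace ℝ (Fin d))‖ := by fun_prop
    exact this hM
  rw [Measure.toSphere_apply' _ hms]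
  refine mul_eq_zero_of_right _ ?_
  -- `toSphere` measures a subset of the sphere by the cone over it, so the set is extended to be
  -- homogeneous of degree zero. Its volume is then computed by Fubini along lines parallel to `a`.
  set C : Set (EuclideanSpace ℝ (Fin d)) := {y | ‖a + ‖y‖⁻¹ • y‖ ∈ M} with hC
  have hCm : MeasurableSet C := by
    have : Measurable fun y : EuclideanSpace ℝ (Fin d) => ‖a + ‖y‖⁻¹ • y‖ := by fun_prop
    exact this hM
  suffices h : volume C = 0 by
    refine measure_mono_null ?_ h
    rintro _ ⟨t, ht, _, ⟨ω, hω, rfl⟩, rfl⟩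
    have h1 : ‖(ω : EuclideanSpace ℝ (Fin d))‖ = 1 := by simp
    have h2 : (t : ℝ) ≠ 0 := ht.1.ne'
    simp only [hC, Set.mem_ofPred_eq, norm_smul, h1, mul_one, Real.norm_eq_abs, abs_of_pos ht.1,
      smul_smul, inv_mul_cancel₀ h2, one_smul]
    exact hω
  have hspan : volume (Submodule.span ℝ {a} : Set (EuclideanSpace ℝ (Fin d))) = 0 := by
    apply Measure.addHaar_submodule
    intro htop
    have h1 := finrank_span_singleton (K := ℝ) (v := a) (by
      intro h; rw [h, norm_zero] at ha; exact zero_ne_one ha)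
    rw [htop, finrank_top, finrank_euclideanSpace_fin] at h1
    omega
  have hline := (ae_ae_add_linearMap_mem_iff (LinearMap.toSpanSingleton ℝ _ a)
    (volume : Measure ℝ) (volume : Measure (EuclideanSpace ℝ (Fin d))) hCm.compl).1 ?_
  · simpa [ae_iff] using hline
  have hns : ∀ᵐ y : EuclideanSpace ℝ (Fin d), y ∉ Submodule.span ℝ {a} := by
    simpa [ae_iff] using hspan
  filter_upwards [hns] with y hy
  set s : ℝ := inner ℝ a y with hs
  set z : EuclideanSpace ℝ (Fin d) := y - s • a with hz
  have hz0 : z ≠ 0 := by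
    intro h
    apply hy
    rw [sub_eq_zero.1 h]
    exact Submodule.smul_mem _ _ (Submodule.mem_span_singleton_self _)
  have haa : inner ℝ a a = (1 : ℝ) := by rw [real_inner_self_eq_norm_sq, ha]; norm_num
  have hza : inner ℝ a z = (0 : ℝ) := by
    rw [hz, inner_sub_right, inner_smul_right, haa, ← hs]; ring
  have hzn : 0 < ‖z‖ := norm_pos_iff.2 hz0
  -- For a unit vector `b`, `‖a + b‖ = r` means that the cosine of the angle between `a` and `b` is
  -- `r²/2 - 1`. With the component `z` orthogonal to `a` fixed, `φ` recovers the position `t` on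
  -- the line from `r`; being differentiable, it sends null sets to null sets.
  set w : ℝ → ℝ := fun r => r ^ 2 / 2 - 1 with hw
  set φ : ℝ → ℝ := fun r => ‖z‖ * w r / Real.sqrt (1 - w r ^ 2) - s with hφ
  have himg : volume (φ '' (M ∩ {r | 0 < 1 - w r ^ 2})) = 0 := by
    apply addHaar_image_eq_zero_of_differentiableOn_of_addHaar_eq_zero
    · intro r hr
      have hr' : 0 < 1 - w r ^ 2 := hr.2
      have hwd : Differentiable ℝ w := by fun_prop
      refine DifferentiableAt.differentiableWithinAt ?_
      have hden : DifferentiableAt ℝ (fun r => Real.sqrt (1 - w r ^ 2)) r :=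
        DifferentiableAt.sqrt (by fun_prop) hr'.ne'
      exact DifferentiableAt.sub_const (DifferentiableAt.div (by fun_prop) hden
        (Real.sqrt_pos.2 hr').ne') _
    · exact measure_mono_null Set.inter_subset_left h0
  rw [ae_iff]
  refine measure_mono_null ?_ himg
  intro t ht
  simp only [LinearMap.toSpanSingleton_apply, Set.mem_compl_iff, not_not, Set.mem_ofPred_eq, hC] at ht
  set x := y + t • a with hx
  have hxz : x = z + (s + t) • a := by rw [hx, hz]; module
  have hnx : ‖x‖ ^ 2 = ‖z‖ ^ 2 + (s + t) ^ 2 := by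
    rw [hxz, ← real_inner_self_eq_norm_sq, ← real_inner_self_eq_norm_sq]
    simp only [inner_add_left, inner_add_right, real_inner_smul_left, real_inner_smul_right, haa,
      hza, real_inner_comm a z]
    ring
  have hxpos : 0 < ‖x‖ := by
    have : 0 < ‖x‖ ^ 2 := by rw [hnx]; positivity
    exact (norm_nonneg x).lt_of_ne' (by rintro h; simp [h] at this)
  have hax : inner ℝ a x = s + t := by
    rw [hxz, inner_add_right, inner_smul_right, haa, hza]; ring
  have hwr : w ‖a + ‖x‖⁻¹ • x‖ = (s + t) / ‖x‖ := by
    simp only [hw]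
    rw [norm_add_sq_real, ha, inner_smul_right, hax, norm_smul, norm_inv, norm_norm,
      inv_mul_cancel₀ hxpos.ne']
    field_simp
    ring
  have h1w : 1 - w ‖a + ‖x‖⁻¹ • x‖ ^ 2 = (‖z‖ / ‖x‖) ^ 2 := by
    rw [hwr]
    field_simp
    linarith
  refine ⟨‖a + ‖x‖⁻¹ • x‖, ⟨ht, ?_⟩, ?_⟩
  · simp only [Set.mem_ofPred_eq]
    rw [h1w]
    positivity
  · simp only [hφ]
    rw [h1w, Real.sqrt_sq (by positivity), hwr]
    field_simp
    ring

/-- The transform of `σ * σ` is the square of a radial function, so only the law of the norm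
matters; with the first point fixed, this is `surf_norm_add_mem_null`. -/
theorem surf_conv_surf_absolutelyContinuous {d : ℕ} (hd : 2 ≤ d) :
    Measure.conv ((surf d).map Subtype.val) ((surf d).map Subtype.val) ≪
      (volume : Measure (EuclideanSpace ℝ (Fin d))) := by
  apply absolutelyContinuous_of_charFun_radial (by omega)
  · intro ξ η h
    rw [charFun_conv, charFun_conv, charFun_surf_eq_of_norm_eq h]
  · refine Measure.AbsolutelyContinuous.mk fun M hM h0 => ?_
    rw [Measure.map_apply measurable_norm hM, Measure.conv,
      Measure.map_apply (by fun_prop) (measurable_norm hM),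
      Measure.map_prod_map _ _ measurable_subtype_coe measurable_subtype_coe,
      Measure.map_apply (by fun_prop) ((by fun_prop : Measurable fun x :
        EuclideanSpace ℝ (Fin d) × EuclideanSpace ℝ (Fin d) => x.1 + x.2) (measurable_norm hM)),
      Measure.measure_prod_null]
    · filter_upwards with a
      exact surf_norm_add_mem_null hd (by simp) hM h0
    · have : Measurable fun x : Sph d × Sph d =>
        ‖(x.1 : EuclideanSpace ℝ (Fin d)) + (x.2 : EuclideanSpace ℝ (Fin d))‖ := by fun_prop
      exact this hM

theorem measurable_sum_sph (d k : ℕ) :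
    Measurable fun ζ : Fin k → Sph d => ∑ j, (ζ j : EuclideanSpace ℝ (Fin d)) :=
  Finset.measurable_sum _ fun j _ => measurable_subtype_coe.comp (measurable_pi_apply j)

instance (d k : ℕ) : IsFiniteMeasure (surfConv d k) := Measure.isFiniteMeasure_map _ _

theorem charFun_surfConv (d k : ℕ) (ξ : EuclideanSpace ℝ (Fin d)) :
    charFun (surfConv d k) ξ = charFun ((surf d).map Subtype.val) ξ ^ k := by
  rw [charFun_apply, surfConv, integral_map (measurable_sum_sph d k).aemeasurable (by fun_prop),
    charFun_apply,
    integral_map (by fun_prop) (by fun_prop)]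
  simp only [sum_inner, Complex.ofReal_sum, Finset.sum_mul, Complex.exp_sum]
  rw [integral_fintype_prod_eq_prod (f := fun _ (a : Sph d) =>
    Complex.exp ((inner ℝ (a : EuclideanSpace ℝ (Fin d)) ξ : ℝ) * Complex.I))]
  simp

/-- Comparing characteristic functions gives `σ^{(k)} = σ^{(k-2)} * (σ * σ)`, where the zeroth
convolution is the Dirac mass at the origin, and convolution preserves absolute continuity. -/
theorem surfConv_absolutelyContinuous {d k : ℕ} (hd : 2 ≤ d) (hk : 2 ≤ k) :
    surfConv d k ≪ (volume : Measure (EuclideanSpace ℝ (Fin d))) := by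
  have : surfConv d k = Measure.conv (surfConv d (k - 2))
      (Measure.conv ((surf d).map Subtype.val) ((surf d).map Subtype.val)) := by
    apply Measure.ext_of_charFun
    ext ξ
    rw [charFun_conv, charFun_conv, charFun_surfConv, charFun_surfConv, ← pow_two, ← pow_add,
      Nat.sub_add_cancel hk]
  rw [this]
  exact Measure.conv_absolutelyContinuous (surf_conv_surf_absolutelyContinuous hd)

end SphereRestriction

/-! ### Conditional expectation as an orthogonal projection of `L²` -/

section CondExpL2

variable {Ω : Type*} {m m₀ : MeasurableSpace Ω} {P : Measure Ω}

/-- Conditional expectation is a contraction on `L²`. -/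
theorem eLpNorm_two_condExp_le [IsFiniteMeasure P] (hm : m ≤ m₀) {g : Ω → ℂ}
    (hg : MemLp g 2 P) : eLpNorm (P[g | m]) 2 P ≤ eLpNorm g 2 P := by
  rw [← eLpNorm_congr_ae (hg.condExpL2_ae_eq_condExp (𝕜 := ℂ) hm),
    ← eLpNorm_congr_ae hg.coeFn_toLp]
  exact eLpNorm_condExpL2_le hm _

/-- Conditional expectation preserves the `L²` norm exactly on the measurable functions. -/
theorem eLpNorm_two_condExp_eq_iff [IsFiniteMeasure P] (hm : m ≤ m₀) {g : Ω → ℂ}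
    (hg : MemLp g 2 P) :
    eLpNorm (P[g | m]) 2 P = eLpNorm g 2 P ↔ AEStronglyMeasurable[m] g P := by
  have : Fact (m ≤ m₀) := ⟨hm⟩
  -- An orthogonal projection preserves the norm of a vector exactly when the vector lies in its
  -- range.
  have h := Submodule.mem_iff_norm_starProjection (lpMeas ℂ ℂ m 2 P) (hg.toLp g)
  have h1 : (lpMeas ℂ ℂ m 2 P).starProjection (hg.toLp g)
      = (condExpL2 ℂ ℂ hm (hg.toLp g) : Lp ℂ 2 P) := rfl
  rw [mem_lpMeas_iff_aestronglyMeasurable, h1, Lp.norm_def, Lp.norm_def,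
    ENNReal.toReal_eq_toReal_iff' (Lp.eLpNorm_ne_top _) (Lp.eLpNorm_ne_top _),
    eLpNorm_congr_ae (hg.condExpL2_ae_eq_condExp (𝕜 := ℂ) hm),
    eLpNorm_congr_ae hg.coeFn_toLp] at h
  rw [← h]
  exact ⟨fun H => H.congr hg.coeFn_toLp, fun H => H.congr hg.coeFn_toLp.symm⟩

end CondExpL2

/-! ### The sharp inequality for a general push-forward -/

section PushForward

variable {Ω : Type*} [MeasurableSpace Ω] {P : Measure Ω} [IsFiniteMeasure P] {d : ℕ}
  {X : Ω → EuclideanSpace ℝ (Fin d)} {G : Ω → ℂ}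

/-- The square root of the density of the law of `X`, evaluated at `X`. -/
noncomputable def sqrtDensity (P : Measure Ω) (X : Ω → EuclideanSpace ℝ (Fin d)) (ω : Ω) : ℝ :=
  Real.sqrt (((P.map X).rnDeriv volume (X ω)).toReal)

theorem stronglyMeasurable_sqrtDensity (P : Measure Ω) (X : Ω → EuclideanSpace ℝ (Fin d)) :
    StronglyMeasurable[MeasurableSpace.comap X inferInstance] (sqrtDensity P X) := by
  refine Measurable.stronglyMeasurable ?_
  have : Measurable fun x => Real.sqrt (((P.map X).rnDeriv volume x).toReal) :=
    ((Measure.measurable_rnDeriv _ _).ennreal_toReal).sqrt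
  exact this.comp (comap_measurable X)

/-- Under the law itself the density is almost surely finite and positive. Positivity is what later
allows division by the square root. -/
theorem enorm_sqrtDensity_sq (hX : Measurable X) (hac : P.map X ≪ volume) :
    ∀ᵐ ω ∂P, ‖sqrtDensity P X ω‖ₑ ^ 2 = (P.map X).rnDeriv volume (X ω) ∧
      sqrtDensity P X ω ≠ 0 := by
  have hfin : ∀ᵐ ω ∂P, (P.map X).rnDeriv volume (X ω) < ∞ :=
    ae_of_ae_map hX.aemeasurable (hac.ae_le (Measure.rnDeriv_lt_top _ _))
  have hpos : ∀ᵐ ω ∂P, 0 < (P.map X).rnDeriv volume (X ω) :=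
    ae_of_ae_map hX.aemeasurable (Measure.rnDeriv_pos hac)
  filter_upwards [hfin, hpos] with ω h1 h2
  have h3 := ENNReal.toReal_pos h2.ne' h1.ne
  refine ⟨?_, (Real.sqrt_pos.2 h3).ne'⟩
  rw [sqrtDensity, Real.enorm_of_nonneg (Real.sqrt_nonneg _), ← ENNReal.ofReal_pow
    (Real.sqrt_nonneg _), Real.sq_sqrt h3.le, ENNReal.ofReal_toReal h1.ne]

/-- The Fourier transform of the push-forward of `G P` under `X`, in `L²`, in terms of the
conditional expectation of `G` given `X`. -/
theorem eLpNorm_fourier_pushforward (hX : Measurable X) (hac : P.map X ≪ volume)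
    (hG : Integrable G P) (hW : MemLp (sqrtDensity P X • G) 2 P) :
    eLpNorm (fun ξ : EuclideanSpace ℝ (Fin d) =>
      ∫ ω, Complex.exp (-Complex.I * (inner ℝ (X ω) ξ : ℝ)) * G ω ∂P) 2 volume ^ 2
      = ENNReal.ofReal ((2 * Real.pi) ^ d) *
        eLpNorm (P[sqrtDensity P X • G | MeasurableSpace.comap X inferInstance]) 2 P ^ 2 := by
  have hm : MeasurableSpace.comap X inferInstance ≤ (inferInstance : MeasurableSpace Ω) :=
    hX.comap_le
  -- Doob–Dynkin factorization `E[G | X] = h ∘ X`.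
  obtain ⟨h, hh, hc⟩ := (stronglyMeasurable_condExp (f := G) (μ := P)
    (m := MeasurableSpace.comap X inferInstance)).exists_eq_measurable_comp
  set ρ := (P.map X).rnDeriv volume with hρ
  have hfin : IsFiniteMeasure (P.map X) := Measure.isFiniteMeasure_map _ _
  have hpull : P[sqrtDensity P X • G | MeasurableSpace.comap X inferInstance]
      =ᵐ[P] sqrtDensity P X • (h ∘ X) := by
    rw [← hc]
    exact condExp_smul_of_aestronglyMeasurable_left
      (stronglyMeasurable_sqrtDensity P X).aestronglyMeasurable
      (memLp_one_iff_integrable.1 (hW.mono_exponent one_le_two)) hG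
  have hint : Integrable h (P.map X) := by
    rw [integrable_map_measure hh.aestronglyMeasurable hX.aemeasurable, ← hc]
    exact integrable_condExp
  set F : EuclideanSpace ℝ (Fin d) → ℂ := fun x => (ρ x).toReal • h x with hF
  have hF1 : Integrable F := (integrable_rnDeriv_smul_iff hac).2 hint
  -- One factor `ρ` of `ρ²|h|²` turns Lebesgue measure into the law of `X`; the other is absorbed as
  -- `√ρ(X)` inside the conditional expectation.
  have hnorm : ∫⁻ x, ‖F x‖ₑ ^ 2 = ∫⁻ ω, ‖P[sqrtDensity P X • G |
      MeasurableSpace.comap X inferInstance] ω‖ₑ ^ 2 ∂P := by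
    have e1 : ∫⁻ x, ‖F x‖ₑ ^ 2 = ∫⁻ x, ρ x * (ρ x * ‖h x‖ₑ ^ 2) := by
      apply lintegral_congr_ae
      filter_upwards [Measure.rnDeriv_lt_top (P.map X) volume] with x hx
      rw [hF]
      simp only
      rw [enorm_smul, Real.enorm_of_nonneg ENNReal.toReal_nonneg, ENNReal.ofReal_toReal hx.ne]
      ring
    have hρm : Measurable ρ := Measure.measurable_rnDeriv _ _
    have hmeas : Measurable fun x => ρ x * ‖h x‖ₑ ^ 2 :=
      hρm.mul (hh.measurable.enorm.pow_const 2)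
    rw [e1, lintegral_rnDeriv_mul hac hmeas.aemeasurable, lintegral_map hmeas hX]
    apply lintegral_congr_ae
    filter_upwards [hpull, enorm_sqrtDensity_sq hX hac] with ω h1 h2
    rw [h1, Pi.smul_apply', enorm_smul, mul_pow, h2.1]
    rfl
  have hF2 : MemLp F 2 := by
    refine ⟨hF1.1, lt_top_iff_ne_top.2 fun htop => ?_⟩
    have h1 := eLpNorm_two_sq_eq_lintegral (P := volume) F
    rw [hnorm, htop, ← eLpNorm_two_sq_eq_lintegral] at h1
    have h2 := (eLpNorm_two_condExp_le hm hW).trans_lt hW.2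
    exact (ENNReal.pow_lt_top h2).ne (by rw [← h1]; simp)
  rw [eLpNorm_two_sq_eq_lintegral (P := P), ← hnorm, ← eLpNorm_two_sq_eq_lintegral,
    ← eLpNorm_sq_integral_exp_neg_inner hF1 hF2]
  congr 2
  ext ξ
  have hexp : ∀ x : EuclideanSpace ℝ (Fin d),
      ‖Complex.exp (-Complex.I * (inner ℝ x ξ : ℝ))‖ = 1 := by
    intro x
    rw [neg_mul, mul_comm, ← neg_mul, ← Complex.ofReal_neg, Complex.norm_exp_ofReal_mul_I]
  have e2 : ∫ x, Complex.exp (-Complex.I * (inner ℝ x ξ : ℝ)) * F x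
      = ∫ x, (ρ x).toReal • (Complex.exp (-Complex.I * (inner ℝ x ξ : ℝ)) * h x) := by
    congr 1
    ext x
    simp only [hF, Complex.real_smul]
    ring
  have hme : Measurable fun x : EuclideanSpace ℝ (Fin d) =>
    Complex.exp (-Complex.I * (inner ℝ x ξ : ℝ)) := by fun_prop
  have hmh : AEStronglyMeasurable (fun x : EuclideanSpace ℝ (Fin d) =>
      Complex.exp (-Complex.I * (inner ℝ x ξ : ℝ)) * h x) (P.map X) :=
    (hme.mul hh.measurable).aestronglyMeasurable
  rw [e2, integral_rnDeriv_smul hac, integral_map hX.aemeasurable hmh]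
  have hintG : Integrable (fun ω => Complex.exp (-Complex.I * (inner ℝ (X ω) ξ : ℝ)) * G ω) P :=
    hG.bdd_mul (c := 1) (hme.comp hX).aestronglyMeasurable
      (Filter.Eventually.of_forall fun ω => (hexp _).le)
  rw [← integral_condExp hm]
  apply integral_congr_ae
  have := condExp_bilin_of_aestronglyMeasurable_left (ContinuousLinearMap.mul ℝ ℂ)
    (m := MeasurableSpace.comap X inferInstance)
    (f := fun ω => Complex.exp (-Complex.I * (inner ℝ (X ω) ξ : ℝ)))
    ((hme.comp (comap_measurable X)).stronglyMeasurable.aestronglyMeasurable) hintG hG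
  refine this.trans ?_
  rw [hc]
  rfl

theorem aestronglyMeasurable_sqrtDensity_smul_iff (hX : Measurable X) (hac : P.map X ≪ volume) :
    AEStronglyMeasurable[MeasurableSpace.comap X inferInstance] (sqrtDensity P X • G) P ↔
      AEStronglyMeasurable[MeasurableSpace.comap X inferInstance] G P := by
  have hs := stronglyMeasurable_sqrtDensity P X
  refine ⟨fun h => ?_, fun h => hs.aestronglyMeasurable.smul h⟩
  have h2 : AEStronglyMeasurable[MeasurableSpace.comap X inferInstance]
      ((sqrtDensity P X)⁻¹ • (sqrtDensity P X • G)) P :=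
    (hs.measurable.inv.stronglyMeasurable.aestronglyMeasurable).smul h
  refine h2.congr ?_
  filter_upwards [enorm_sqrtDensity_sq hX hac] with ω hω
  simp [hω.2]

/-- The sharp inequality for the Fourier transform of a push-forward, with its case of equality. -/
theorem eLpNorm_fourier_pushforward_le_and_eq_iff (hX : Measurable X) (hac : P.map X ≪ volume)
    (hG : Integrable G P)
    (hW : ∫⁻ ω, (P.map X).rnDeriv volume (X ω) * ‖G ω‖ₑ ^ 2 ∂P ≠ ∞) :
    let T := eLpNorm (fun ξ : EuclideanSpace ℝ (Fin d) =>
      ∫ ω, Complex.exp (-Complex.I * (inner ℝ (X ω) ξ : ℝ)) * G ω ∂P) 2 volume ^ 2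
    let W := ENNReal.ofReal ((2 * Real.pi) ^ d) *
      ∫⁻ ω, (P.map X).rnDeriv volume (X ω) * ‖G ω‖ₑ ^ 2 ∂P
    T ≤ W ∧ (T = W ↔ AEStronglyMeasurable[MeasurableSpace.comap X inferInstance] G P) := by
  intro T W
  have hm : MeasurableSpace.comap X inferInstance ≤ (inferInstance : MeasurableSpace Ω) :=
    hX.comap_le
  have e : ∫⁻ ω, (P.map X).rnDeriv volume (X ω) * ‖G ω‖ₑ ^ 2 ∂P
      = eLpNorm (sqrtDensity P X • G) 2 P ^ 2 := by
    rw [eLpNorm_two_sq_eq_lintegral]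
    apply lintegral_congr_ae
    filter_upwards [enorm_sqrtDensity_sq hX hac] with ω hω
    rw [Pi.smul_apply', enorm_smul, mul_pow, hω.1]
  have hmem : MemLp (sqrtDensity P X • G) 2 P := by
    refine ⟨((stronglyMeasurable_sqrtDensity P X).mono hm).aestronglyMeasurable.smul hG.1,
      lt_top_iff_ne_top.2 fun htop => hW ?_⟩
    rw [e, htop]
    simp
  have hT : T = ENNReal.ofReal ((2 * Real.pi) ^ d) *
        eLpNorm (P[sqrtDensity P X • G | MeasurableSpace.comap X inferInstance]) 2 P ^ 2 :=
    eLpNorm_fourier_pushforward hX hac hG hmem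
  have hW' : W = ENNReal.ofReal ((2 * Real.pi) ^ d) * eLpNorm (sqrtDensity P X • G) 2 P ^ 2 := by
    rw [← e]
  have hle := eLpNorm_two_condExp_le hm hmem
  refine ⟨?_, ?_⟩
  · rw [hT, hW']
    gcongr
  · rw [hT, hW', ← aestronglyMeasurable_sqrtDensity_smul_iff hX hac,
      ← eLpNorm_two_condExp_eq_iff hm hmem,
      ENNReal.mul_right_inj (by simp; positivity) ENNReal.ofReal_ne_top]
    exact ⟨fun h => (ENNReal.pow_right_strictMono two_ne_zero).injective h, fun h => by rw [h]⟩

end PushForward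

/-! ### The sharp inequality on products of spheres -/

namespace SphereRestriction

theorem fourierSurf_prod {d k : ℕ} (f : Fin k → Sph d → ℂ) (ξ : EuclideanSpace ℝ (Fin d)) :
    ∏ j, fourierSurf (f j) ξ
      = ∫ ζ : Fin k → Sph d, Complex.exp (-Complex.I *
          (inner ℝ (∑ j, (ζ j : EuclideanSpace ℝ (Fin d))) ξ : ℝ)) * ∏ j, f j (ζ j)
          ∂(Measure.pi fun _ => surf d) := by
  simp only [fourierSurf]
  rw [← integral_fintype_prod_eq_prod]
  congr 1
  ext ζ
  rw [Finset.prod_mul_distrib, ← Complex.exp_sum, sum_inner, Complex.ofReal_sum, Finset.mul_sum]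

/-- The sharp inequality, together with the reduction of the case of equality to a functional
equation. -/
theorem prodNormSq_le_and_eq_iff {d k : ℕ} (hd : 2 ≤ d) (hk : 2 ≤ k) {f : Fin k → Sph d → ℂ}
    (hf : ∀ j, Integrable (f j) (surf d)) (hW : weightedIntegral f ≠ ∞) :
    prodNormSq f ≤ weightedIntegral f ∧
    (prodNormSq f = weightedIntegral f ↔
      AEStronglyMeasurable[MeasurableSpace.comap
        (fun ζ : Fin k → Sph d => ∑ j, (ζ j : EuclideanSpace ℝ (Fin d))) inferInstance]
        (fun ζ : Fin k → Sph d => ∏ j, f j (ζ j)) (Measure.pi fun _ => surf d)) := by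
  have hG : Integrable (fun ζ : Fin k → Sph d => ∏ j, f j (ζ j)) (Measure.pi fun _ => surf d) :=
    Integrable.fintype_prod hf
  have hac : (Measure.pi fun _ : Fin k => surf d).map
    (fun ζ => ∑ j, (ζ j : EuclideanSpace ℝ (Fin d))) ≪ volume := surfConv_absolutelyContinuous hd hk
  have henorm : ∀ ζ : Fin k → Sph d, ‖∏ j, f j (ζ j)‖ₑ ^ 2 = ∏ j, ‖f j (ζ j)‖ₑ ^ 2 := by
    intro ζ
    simp [enorm_eq_nnnorm, nnnorm_prod, Finset.prod_pow]
  have hpos : ENNReal.ofReal ((2 * Real.pi) ^ d) ≠ 0 := by simp; positivity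
  have key := eLpNorm_fourier_pushforward_le_and_eq_iff (measurable_sum_sph d k) hac hG
  simp only [henorm, ← fourierSurf_prod] at key
  refine key fun h => hW ?_
  rw [weightedIntegral]
  have h' : ∫⁻ ζ : Fin k → Sph d,
      surfConvDensity d k (∑ j, (ζ j : EuclideanSpace ℝ (Fin d))) * ∏ j, ‖f j (ζ j)‖ₑ ^ 2
      ∂(Measure.pi fun _ : Fin k => surf d) = ∞ := h
  rw [h', ENNReal.mul_top hpos]

end SphereRestriction

/-! ### Exponential moments on the sphere -/

noncomputable section

namespace SphereRestriction

variable {d : ℕ}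

/-- The exponential `a ↦ e^{z·a}` on the sphere, for `z ∈ ℂ^d`. -/
def expDot (z : Fin d → ℂ) (a : Sph d) : ℂ :=
  Complex.exp (∑ i, z i * ((a : EuclideanSpace ℝ (Fin d)) i : ℂ))

/-- The coordinate function `a ↦ a_i` on the sphere, with complex values. -/
def coord (i : Fin d) (a : Sph d) : ℂ := ((a : EuclideanSpace ℝ (Fin d)) i : ℂ)

/-- The exponential moment `∫ u(a) e^{z·a} dσ(a)`. -/
def expMoment (u : Sph d → ℂ) (z : Fin d → ℂ) : ℂ := ∫ a, u a * expDot z a ∂(surf d)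

/-- The exponential moment `∫ u(a) a_i e^{z·a} dσ(a)`. -/
def coordMoment (u : Sph d → ℂ) (z : Fin d → ℂ) (i : Fin d) : ℂ :=
  ∫ a, u a * (coord i a * expDot z a) ∂(surf d)

/-- The purely imaginary vector `i ξ`. -/
def imagVec (ξ : EuclideanSpace ℝ (Fin d)) : Fin d → ℂ := fun i => (ξ i : ℂ) * Complex.I

@[fun_prop]
theorem continuous_coord (i : Fin d) : Continuous (coord i : Sph d → ℂ) := by
  unfold coord; fun_prop

@[fun_prop]
theorem continuous_expDot (z : Fin d → ℂ) : Continuous (expDot z : Sph d → ℂ) := by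
  unfold expDot; fun_prop

theorem expDot_add (z w : Fin d → ℂ) (a : Sph d) : expDot (z + w) a = expDot z a * expDot w a := by
  simp [expDot, ← Complex.exp_add, add_mul, Finset.sum_add_distrib]

theorem expDot_zero (a : Sph d) : expDot 0 a = 1 := by simp [expDot]

theorem expDot_imagVec (ξ : EuclideanSpace ℝ (Fin d)) (a : Sph d) :
    expDot (imagVec ξ) a
      = Complex.exp ((inner ℝ (a : EuclideanSpace ℝ (Fin d)) ξ : ℝ) * Complex.I) := by
  simp only [expDot, imagVec, PiLp.inner_apply]
  congr 1
  push_cast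
  rw [Finset.sum_mul]
  refine Finset.sum_congr rfl fun i _ => ?_
  simp
  ring

theorem integrable_mul_continuous {u φ : Sph d → ℂ} (hu : Integrable u (surf d))
    (hφ : Continuous φ) : Integrable (fun a => u a * φ a) (surf d) := by
  obtain ⟨C, hC⟩ := isCompact_univ.exists_bound_of_continuousOn hφ.continuousOn
  exact hu.mul_bdd (c := C) hφ.aestronglyMeasurable
    (Filter.Eventually.of_forall fun a => hC a (Set.mem_univ a))

/-- Fourier uniqueness on the sphere. -/
theorem ae_eq_zero_of_expMoment {u : Sph d → ℂ} (hu : Integrable u (surf d))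
    (h : ∀ ξ, expMoment u (imagVec ξ) = 0) : u =ᵐ[surf d] 0 := by
  refine ae_eq_zero_of_charFun hu
    (X := (Subtype.val : Sph d → EuclideanSpace ℝ (Fin d)))
    (MeasurableEmbedding.subtype_coe Metric.isClosed_sphere.measurableSet) fun ξ => ?_
  rw [← h ξ, expMoment]
  simp only [expDot_imagVec]

/-- Differentiation under the integral sign; the derivative is dominated by `‖u‖` times the maximum
of a continuous function over a compact time interval and the sphere. -/
theorem hasDerivAt_expMoment {u : Sph d → ℂ} (hu : Integrable u (surf d)) {c c' : ℝ → Fin d → ℂ}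
    (hc : ∀ t, HasDerivAt c (c' t) t) (hc' : Continuous c') (t : ℝ) :
    HasDerivAt (fun t => expMoment u (c t)) (∑ i, c' t i * coordMoment u (c t) i) t := by
  have hcc : Continuous c := continuous_iff_continuousAt.2 fun t => (hc t).continuousAt
  have hcont : Continuous fun p : ℝ × Sph d =>
      (∑ i, c' p.1 i * coord i p.2) * expDot (c p.1) p.2 := by
    unfold expDot coord
    fun_prop
  obtain ⟨K, hK⟩ := ((isCompact_closedBall t 1).prod
    (isCompact_univ (X := Sph d))).exists_bound_of_continuousOn hcont.continuousOn
  have key := hasDerivAt_integral_of_dominated_loc_of_deriv_le (μ := surf d)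
    (F := fun t a => u a * expDot (c t) a)
    (F' := fun t a => u a * ((∑ i, c' t i * coord i a) * expDot (c t) a))
    (bound := fun a => ‖u a‖ * K) (x₀ := t) (Metric.ball_mem_nhds t one_pos)
    (Filter.Eventually.of_forall fun t =>
      (integrable_mul_continuous hu (continuous_expDot (c t))).aestronglyMeasurable)
    (integrable_mul_continuous hu (continuous_expDot (c t)))
    (integrable_mul_continuous hu (by fun_prop)).aestronglyMeasurable
    (Filter.Eventually.of_forall fun a s hs => by
      rw [norm_mul]
      gcongr
      exact hK (s, a) ⟨Metric.ball_subset_closedBall hs, Set.mem_univ a⟩)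
    (hu.norm.mul_const K)
    (Filter.Eventually.of_forall fun a s _ => by
      have h1 : HasDerivAt (fun s => ∑ i, c s i * ((a : EuclideanSpace ℝ (Fin d)) i : ℂ))
          (∑ i, c' s i * coord i a) s := by
        refine HasDerivAt.fun_sum fun i _ => ?_
        exact ((hasDerivAt_pi.1 (hc s)) i).mul_const _
      have h2 := (h1.cexp).const_mul (u a)
      refine h2.congr_deriv ?_
      rw [expDot]
      ring)
  refine key.2.congr_deriv ?_
  simp only [coordMoment]
  simp only [← integral_const_mul]
  rw [← integral_finsetSum]
  · congr 1
    ext a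
    rw [Finset.sum_mul, Finset.mul_sum]
    exact Finset.sum_congr rfl fun i _ => by ring
  · intro i _
    exact (integrable_mul_continuous hu (by fun_prop)).const_mul _

/-! ### Rotational derivatives of moments -/

/-- Invariance of the exponential moments of the surface measure under the reflection orthogonal
to a unit vector. -/
theorem expMoment_one_reflection (z : Fin d → ℂ) {v : EuclideanSpace ℝ (Fin d)} (hv : ‖v‖ = 1) :
    expMoment (fun _ : Sph d => 1) (fun i => z i - 2 * (∑ r, z r * v r) * v i)
      = expMoment (fun _ : Sph d => 1) z := by
  set R := (Submodule.span ℝ {v})ᗮ.reflection with hR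
  have hRa : ∀ a : EuclideanSpace ℝ (Fin d), R a = a - (2 * inner ℝ v a) • v := by
    intro a
    rw [hR, Submodule.reflection_orthogonal_apply, Submodule.reflection_singleton_apply, hv]
    simp
    module
  set φ : EuclideanSpace ℝ (Fin d) → ℂ := fun x => Complex.exp (∑ i, z i * (x i : ℂ)) with hφ
  have h1 : ∫ x, φ x ∂((surf d).map Subtype.val).map R = ∫ x, φ x ∂((surf d).map Subtype.val) := by
    rw [map_surf_linearIsometryEquiv]
  rw [integral_map R.continuous.measurable.aemeasurable (by fun_prop),
    integral_map (by fun_prop) (by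
      have := R.continuous
      exact Continuous.aestronglyMeasurable (by fun_prop)),
    integral_map (by fun_prop) (by fun_prop)] at h1
  simp only [expMoment, one_mul]
  rw [show (∫ a : Sph d, expDot z a ∂(surf d)) = ∫ a : Sph d, φ a ∂(surf d) from rfl, ← h1]
  congr 1
  ext a
  simp only [hφ, expDot, hRa]
  congr 1
  simp only [PiLp.sub_apply, PiLp.smul_apply, smul_eq_mul, PiLp.inner_apply, RCLike.inner_apply,
    conj_trivial]
  push_cast
  simp only [sub_mul, mul_sub, Finset.sum_sub_distrib]
  congr 1
  simp only [Finset.sum_mul, Finset.mul_sum]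
  rw [Finset.sum_comm]
  exact Finset.sum_congr rfl fun i _ => Finset.sum_congr rfl fun r _ => by ring

/-- The infinitesimal rotation invariance of the surface measure. -/
theorem coordMoment_one_rotation (z : Fin d → ℂ) (j l : Fin d) :
    z l * coordMoment (fun _ : Sph d => 1) z j = z j * coordMoment (fun _ : Sph d => 1) z l := by
  rcases eq_or_ne j l with rfl | hjl
  · rfl
  set ej : Fin d → ℂ := Pi.single j 1 with hej
  set el : Fin d → ℂ := Pi.single l 1 with hel
  -- The rotation is a product of two reflections: `z₀` is `z` reflected along `e_j`, and `c t` is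
  -- `z₀` reflected along `cos t e_j + sin t e_l`. Hence `c 0 = z`, and `c` turns `z` in the plane
  -- of `e_j` and `e_l`.
  set z₀ : Fin d → ℂ := z - (2 * z j) • ej with hz₀
  have hz0j : z₀ j = - z j := by simp [hz₀, hej]; ring
  have hz0l : z₀ l = z l := by simp [hz₀, hej, hjl.symm]
  set p : ℝ → ℂ := fun t => (Real.cos t : ℂ) * z₀ j + (Real.sin t : ℂ) * z₀ l with hp
  set p' : ℝ → ℂ := fun t => (-Real.sin t : ℂ) * z₀ j + (Real.cos t : ℂ) * z₀ l with hp'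
  set q : ℝ → Fin d → ℂ := fun t => (Real.cos t : ℂ) • ej + (Real.sin t : ℂ) • el with hq
  set q' : ℝ → Fin d → ℂ := fun t => (-Real.sin t : ℂ) • ej + (Real.cos t : ℂ) • el with hq'
  have hcos : ∀ t, HasDerivAt (fun t : ℝ => (Real.cos t : ℂ)) (-Real.sin t : ℂ) t := fun t => by
    simpa using (Real.hasDerivAt_cos t).ofReal_comp
  have hsin : ∀ t, HasDerivAt (fun t : ℝ => (Real.sin t : ℂ)) (Real.cos t : ℂ) t := fun t =>
    (Real.hasDerivAt_sin t).ofReal_comp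
  have hpd : ∀ t, HasDerivAt p (p' t) t := fun t =>
    ((hcos t).mul_const _).add ((hsin t).mul_const _)
  have hqd : ∀ t, HasDerivAt q (q' t) t := fun t =>
    ((hcos t).smul_const _).add ((hsin t).smul_const _)
  set c : ℝ → Fin d → ℂ := fun t => z₀ - (2 : ℂ) • (p t • q t) with hc
  have hcd : ∀ t, HasDerivAt c (-((2 : ℂ) • (p t • q' t + p' t • q t))) t := fun t =>
    ((hpd t).smul (hqd t)).const_smul (2 : ℂ) |>.const_sub z₀
  have hconst : ∀ t, expMoment (fun _ : Sph d => 1) (c t) = expMoment (fun _ : Sph d => 1) z₀ := by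
    intro t
    set v : EuclideanSpace ℝ (Fin d) :=
      Real.cos t • EuclideanSpace.single j 1 + Real.sin t • EuclideanSpace.single l 1 with hv
    have hvq : ∀ i, ((v i : ℝ) : ℂ) = q t i := by
      intro i
      simp only [hv, hq, hej, hel, PiLp.add_apply, PiLp.smul_apply, PiLp.single_apply,
        Pi.add_apply, Pi.smul_apply, Pi.single_apply]
      split_ifs <;> simp
    have hnorm : ‖v‖ = 1 := by
      have : ‖v‖ ^ 2 = 1 := by
        rw [hv, norm_add_sq_real]
        simp [norm_smul, inner_smul_left, inner_smul_right, hjl, EuclideanSpace.inner_single_left]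
      exact (pow_eq_one_iff_of_nonneg (norm_nonneg _) two_ne_zero).1 this
    rw [← expMoment_one_reflection z₀ hnorm]
    congr 1
    ext i
    have hsum : ∑ r, z₀ r * ((v r : ℝ) : ℂ) = p t := by
      simp only [hvq, hq, hp, Pi.add_apply, Pi.smul_apply, smul_eq_mul, mul_add,
        Finset.sum_add_distrib, hej, hel]
      simp [Pi.single_apply, mul_comm]
    rw [hsum, hvq]
    simp [hc, mul_assoc]
  have h1 := hasDerivAt_expMoment (u := fun _ : Sph d => 1) (integrable_const _) hcd
    (by fun_prop) 0
  simp only [hconst] at h1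
  have h2 := h1.unique (hasDerivAt_const (0 : ℝ) _)
  have hc0 : c 0 = z := by
    have hp0 : p 0 = -z j := by simp [hp, hz0j]
    have hq0 : q 0 = ej := by simp [hq]
    simp only [hc, hp0, hq0, hz₀]
    module
  rw [hc0] at h2
  simp only [hp, hp', hq, hq', Real.cos_zero, Real.sin_zero, Complex.ofReal_one,
    Complex.ofReal_zero, hz0j, hz0l, Pi.neg_apply, Pi.smul_apply, Pi.add_apply, smul_eq_mul, neg_zero,
    zero_mul, one_mul, zero_add, add_zero, mul_add, neg_mul, add_mul, Finset.sum_add_distrib,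
    Finset.sum_neg_distrib, neg_add, hej, hel] at h2
  simp [Pi.single_apply, mul_assoc] at h2
  -- The factor `1/2` appears because composing the two reflections rotates by twice the angle `t`.
  linear_combination (-1 / 2 : ℂ) * h2

/-- Two vectors of the same norm in dimension at least two lie on a common circle centred at the
origin. -/
theorem exists_eq_cos_smul_add_sin_smul (hd : 2 ≤ d) {ξ η : EuclideanSpace ℝ (Fin d)}
    (hξ : ξ ≠ 0) (hn : ‖ξ‖ = ‖η‖) :
    ∃ (w : EuclideanSpace ℝ (Fin d)) (θ : ℝ), inner ℝ ξ w = 0 ∧ ‖w‖ = ‖ξ‖ ∧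
      η = Real.cos θ • ξ + Real.sin θ • w := by
  have hr : 0 < ‖ξ‖ := norm_pos_iff.2 hξ
  have hξξ : inner ℝ ξ ξ = ‖ξ‖ ^ 2 := real_inner_self_eq_norm_sq ξ
  set c : ℝ := inner ℝ ξ η / ‖ξ‖ ^ 2 with hc
  set y := η - c • ξ with hy
  have hyξ : inner ℝ ξ y = 0 := by
    rw [hy, inner_sub_right, inner_smul_right, hξξ, hc]
    field_simp
    ring
  obtain ⟨w, s, hw1, hw2, hw3⟩ : ∃ (w : EuclideanSpace ℝ (Fin d)) (s : ℝ), inner ℝ ξ w = 0 ∧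
      ‖w‖ = ‖ξ‖ ∧ y = s • w := by
    -- If `η` is a multiple of `ξ`, any orthogonal direction will do; one exists because `d ≥ 2`.
    by_cases hy0 : y = 0
    · have hne : (Submodule.span ℝ {ξ})ᗮ ≠ ⊥ := by
        intro h
        have h1 := Submodule.finrank_add_finrank_orthogonal (Submodule.span ℝ {ξ})
        rw [h, finrank_bot, finrank_span_singleton hξ, finrank_euclideanSpace_fin] at h1
        omega
      obtain ⟨v, hv, hv0⟩ := Submodule.exists_mem_ne_zero_of_ne_bot hne
      have hvn : ‖v‖ ≠ 0 := norm_ne_zero_iff.2 hv0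
      refine ⟨(‖ξ‖ / ‖v‖) • v, 0, ?_, ?_, by simp [hy0]⟩
      · rw [inner_smul_right, Submodule.mem_orthogonal_singleton_iff_inner_right.1 hv, mul_zero]
      · rw [norm_smul, norm_div, norm_norm, norm_norm, div_mul_cancel₀ _ hvn]
    · have hyn : ‖y‖ ≠ 0 := norm_ne_zero_iff.2 hy0
      refine ⟨(‖ξ‖ / ‖y‖) • y, ‖y‖ / ‖ξ‖, ?_, ?_, ?_⟩
      · rw [inner_smul_right, hyξ, mul_zero]
      · rw [norm_smul, norm_div, norm_norm, norm_norm, div_mul_cancel₀ _ hyn]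
      · rw [smul_smul, div_mul_div_cancel₀ hr.ne', div_self hyn, one_smul]
  have hη : η = c • ξ + s • w := by rw [← hw3, hy]; module
  have hcs : c ^ 2 + s ^ 2 = 1 := by
    have h1 : ‖η‖ ^ 2 = (c ^ 2 + s ^ 2) * ‖ξ‖ ^ 2 := by
      rw [hη, norm_add_sq_real, norm_smul, norm_smul, real_inner_smul_left, real_inner_smul_right,
        hw1, hw2, mul_pow, mul_pow, Real.norm_eq_abs, Real.norm_eq_abs, sq_abs, sq_abs]
      ring
    rw [← hn] at h1
    have h2 : 0 < ‖ξ‖ ^ 2 := by positivity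
    nlinarith [mul_right_cancel₀ h2.ne' ((one_mul _).trans h1)]
  have hnorm : ‖(⟨c, s⟩ : ℂ)‖ = 1 := by
    have : ‖(⟨c, s⟩ : ℂ)‖ ^ 2 = 1 := by
      rw [← Complex.normSq_eq_norm_sq, Complex.normSq_mk]; linarith
    exact (pow_eq_one_iff_of_nonneg (norm_nonneg _) two_ne_zero).1 this
  refine ⟨w, Complex.arg ⟨c, s⟩, hw1, hw2, ?_⟩
  rw [Complex.cos_arg (norm_ne_zero_iff.1 (by rw [hnorm]; exact one_ne_zero)), Complex.sin_arg,
    hnorm, div_one, div_one]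
  exact hη

theorem sum_imagVec_mul_imagVec (ξ η : EuclideanSpace ℝ (Fin d)) :
    ∑ i, imagVec ξ i * imagVec η i = -((inner ℝ ξ η : ℝ) : ℂ) := by
  simp only [imagVec, PiLp.inner_apply]
  push_cast
  rw [← Finset.sum_neg_distrib]
  refine Finset.sum_congr rfl fun i _ => ?_
  simp only [RCLike.inner_apply, conj_trivial, Complex.ofReal_mul]
  linear_combination (ξ i : ℂ) * (η i : ℂ) * Complex.I_mul_I

/-- Exponential moments whose rotational derivatives vanish are constant on spheres. -/
theorem expMoment_imagVec_eq_of_norm_eq {g : Sph d → ℂ} (hg : Integrable g (surf d))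
    (hd : 2 ≤ d) (h : ∀ z j l, z l * coordMoment g z j = z j * coordMoment g z l)
    {ξ η : EuclideanSpace ℝ (Fin d)} (hn : ‖ξ‖ = ‖η‖) :
    expMoment g (imagVec ξ) = expMoment g (imagVec η) := by
  by_cases hξ : ξ = 0
  · rw [hξ, norm_zero, eq_comm, norm_eq_zero] at hn
    rw [hξ, hn]
  obtain ⟨w, θ, hw1, hw2, rfl⟩ := exists_eq_cos_smul_add_sin_smul hd hξ hn
  have hcos : ∀ t, HasDerivAt (fun t : ℝ => (Real.cos t : ℂ)) (-Real.sin t : ℂ) t := fun t => by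
    simpa using (Real.hasDerivAt_cos t).ofReal_comp
  have hsin : ∀ t, HasDerivAt (fun t : ℝ => (Real.sin t : ℂ)) (Real.cos t : ℂ) t := fun t =>
    (Real.hasDerivAt_sin t).ofReal_comp
  set c : ℝ → Fin d → ℂ := fun t => imagVec (Real.cos t • ξ + Real.sin t • w) with hc
  set c' : ℝ → Fin d → ℂ := fun t => imagVec (-Real.sin t • ξ + Real.cos t • w) with hc'
  have hcd : ∀ t, HasDerivAt c (c' t) t := by
    intro t
    rw [hasDerivAt_pi]
    intro i
    have h1 := (((hcos t).mul_const (ξ i : ℂ)).add ((hsin t).mul_const (w i : ℂ))).mul_const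
      Complex.I
    refine HasDerivAt.congr_deriv (h1.congr_of_eventuallyEq
      (Filter.Eventually.of_forall fun s => ?_)) ?_
    · simp [hc, imagVec]
    · simp [hc', imagVec]
  have hcc : Continuous c' := by
    rw [hc']
    unfold imagVec
    fun_prop
  have hder : ∀ t, ∑ i, c' t i * coordMoment g (c t) i = 0 := by
    intro t
    have hξξ : inner ℝ ξ ξ = ‖ξ‖ ^ 2 := real_inner_self_eq_norm_sq ξ
    have hww : inner ℝ w w = ‖ξ‖ ^ 2 := by rw [real_inner_self_eq_norm_sq, hw2]
    have hwξ : inner ℝ w ξ = 0 := by rw [real_inner_comm, hw1]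
    have h1 : ∑ i, c t i * c t i = -((‖ξ‖ ^ 2 : ℝ) : ℂ) := by
      rw [hc, sum_imagVec_mul_imagVec]
      congr 2
      simp only [inner_add_left, inner_add_right, real_inner_smul_left, real_inner_smul_right,
        hξξ, hww, hw1, hwξ]
      linear_combination ‖ξ‖ ^ 2 * Real.cos_sq_add_sin_sq t
    have h2 : ∑ i, c t i * c' t i = 0 := by
      rw [hc, hc', sum_imagVec_mul_imagVec]
      rw [neg_eq_zero, Complex.ofReal_eq_zero]
      simp only [inner_add_left, inner_add_right, real_inner_smul_left, real_inner_smul_right,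
        hξξ, hww, hw1, hwξ]
      ring
    -- The hypothesis says that the moment vector is parallel to `c t`, while `c'` is orthogonal to
    -- `c` and `c · c = -‖ξ‖²` is nonzero; so the derivative along the circle vanishes.
    have h3 : (∑ i, c t i * c t i) * ∑ i, c' t i * coordMoment g (c t) i
        = (∑ i, c t i * c' t i) * ∑ i, c t i * coordMoment g (c t) i := by
      rw [Finset.sum_mul_sum, Finset.sum_mul_sum, Finset.sum_comm]
      refine Finset.sum_congr rfl fun j _ => Finset.sum_congr rfl fun l _ => ?_
      linear_combination c t l * c' t j * h (c t) j l
    rw [h2, zero_mul, h1] at h3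
    refine (mul_eq_zero.1 h3).resolve_left ?_
    exact neg_ne_zero.2 (Complex.ofReal_ne_zero.2 (pow_ne_zero _ (norm_ne_zero_iff.2 hξ)))
  have hD : ∀ t, HasDerivAt (fun t => expMoment g (c t)) 0 t := fun t => by
    have := hasDerivAt_expMoment hg hcd hcc t
    rwa [hder t] at this
  have := is_const_of_deriv_eq_zero (fun t => (hD t).differentiableAt) (fun t => (hD t).deriv) 0 θ
  simpa [hc] using this

/-- The transform of `g` is radial. Averaging it over the sphere of radius `‖ξ‖` and using Fubini
turns it into `∫ g` times the transform of `σ`, up to the total mass of `σ`; Fourier uniqueness then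
identifies `g` with its mean. -/
theorem ae_eq_const_of_rotation {g : Sph d → ℂ} (hg : Integrable g (surf d)) (hd : 2 ≤ d)
    (h : ∀ z j l, z l * coordMoment g z j = z j * coordMoment g z l) :
    ∃ c : ℂ, ∀ᵐ a ∂(surf d), g a = c := by
  have hS : ((surf d).real Set.univ : ℂ) ≠ 0 := by
    have : Nonempty (Fin d) := ⟨⟨0, by omega⟩⟩
    have h1 : surf d Set.univ ≠ 0 := Measure.measure_univ_ne_zero.2 (Measure.toSphere_ne_zero _)
    exact_mod_cast (ENNReal.toReal_ne_zero.2 ⟨h1, measure_ne_top _ _⟩)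
  have hrad : ∀ ξ, expMoment g (imagVec ξ) * (surf d).real Set.univ
      = expMoment g 0 * expMoment (fun _ : Sph d => 1) (imagVec ξ) := by
    intro ξ
    have hsym : ∀ a b : Sph d, expDot (imagVec (‖ξ‖ • (b : EuclideanSpace ℝ (Fin d)))) a
        = expDot (imagVec (‖ξ‖ • (a : EuclideanSpace ℝ (Fin d)))) b := by
      intro a b
      rw [expDot_imagVec, expDot_imagVec, inner_smul_right, inner_smul_right, real_inner_comm]
    have e1 : ∫ b : Sph d, expMoment g (imagVec (‖ξ‖ • (b : EuclideanSpace ℝ (Fin d)))) ∂(surf d)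
        = expMoment g (imagVec ξ) * (surf d).real Set.univ := by
      have : ∀ b : Sph d, expMoment g (imagVec (‖ξ‖ • (b : EuclideanSpace ℝ (Fin d))))
          = expMoment g (imagVec ξ) := fun b =>
        expMoment_imagVec_eq_of_norm_eq hg hd h (by simp [norm_smul])
      simp only [this, integral_const, Complex.real_smul]
      ring
    have e2 : ∀ a : Sph d,
        ∫ b, g a * expDot (imagVec (‖ξ‖ • (b : EuclideanSpace ℝ (Fin d)))) a ∂(surf d)
        = g a * expMoment (fun _ : Sph d => 1) (imagVec ξ) := by
      intro a
      rw [integral_const_mul]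
      simp only [hsym a]
      congr 1
      have := charFun_surf_eq_of_norm_eq (ξ := ‖ξ‖ • (a : EuclideanSpace ℝ (Fin d))) (η := ξ)
        (by simp [norm_smul])
      rw [charFun_apply, charFun_apply, integral_map (by fun_prop) (by fun_prop),
        integral_map (by fun_prop) (by fun_prop)] at this
      simp only [expMoment, expDot_imagVec, one_mul]
      exact this
    rw [← e1]
    simp only [expMoment] at e2 ⊢
    rw [integral_integral_swap]
    · simp only [e2, integral_mul_const, expDot_zero, mul_one]
    · have : Continuous fun p : Sph d × Sph d =>
          expDot (imagVec (‖ξ‖ • (p.1 : EuclideanSpace ℝ (Fin d)))) p.2 := by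
        unfold expDot imagVec
        fun_prop
      refine (hg.comp_snd (surf d)).mul_bdd (c := 1) this.aestronglyMeasurable
        (Filter.Eventually.of_forall fun p => ?_)
      rw [expDot_imagVec, Complex.norm_exp_ofReal_mul_I]
  have hu : Integrable (fun a => g a * (surf d).real Set.univ - expMoment g 0) (surf d) :=
    (hg.mul_const _).sub (integrable_const _)
  have h0 := ae_eq_zero_of_expMoment hu fun ξ => by
    have h1 := hrad ξ
    have i1 := integrable_mul_continuous hg (continuous_expDot (imagVec ξ))
    have i2 := integrable_mul_continuous (integrable_const (1 : ℂ)) (continuous_expDot (imagVec ξ))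
    rw [← sub_eq_zero] at h1
    rw [← h1]
    generalize expMoment g 0 = C
    simp only [expMoment]
    rw [← integral_mul_const, ← integral_const_mul, ← integral_sub (i1.mul_const _) (i2.const_mul _)]
    congr 1
    ext a
    ring
  refine ⟨expMoment g 0 / (surf d).real Set.univ, ?_⟩
  filter_upwards [h0] with a ha
  rw [eq_div_iff hS]
  exact sub_eq_zero.1 ha

/-! ### Orthogonality relations from the functional equation -/

/-- If `∏ f_j(ζ_j)` is a function of `ζ_1 + ⋯ + ζ_k`, then it is orthogonal to every sum of product
functions whose push-forward under `ζ ↦ ζ_1 + ⋯ + ζ_k` vanishes. -/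
theorem sum_prod_integral_eq_zero {k : ℕ} {f : Fin k → Sph d → ℂ}
    (hf : ∀ j, Integrable (f j) (surf d))
    (hG : AEStronglyMeasurable[MeasurableSpace.comap
        (fun ζ : Fin k → Sph d => ∑ j, (ζ j : EuclideanSpace ℝ (Fin d))) inferInstance]
        (fun ζ : Fin k → Sph d => ∏ j, f j (ζ j)) (Measure.pi fun _ => surf d))
    {S : Type*} [Fintype S] (ψ : S → Fin k → Sph d → ℂ) (hψ : ∀ s j, Continuous (ψ s j))
    (h0 : ∀ ξ, ∑ s, ∏ j, ∫ a, ψ s j a * expDot (imagVec ξ) a ∂(surf d) = 0) :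
    ∑ s, ∏ j, ∫ a, f j a * ψ s j a ∂(surf d) = 0 := by
  have hψi : ∀ s j, Integrable (ψ s j) (surf d) := fun s j => by
    simpa using integrable_mul_continuous (integrable_const (1 : ℂ)) (hψ s j)
  have hint : ∀ s, Integrable (fun ζ : Fin k → Sph d => ∏ j, ψ s j (ζ j))
      (Measure.pi fun _ => surf d) := fun s => Integrable.fintype_prod (hψi s)
  have hfint : ∀ s, Integrable (fun ζ : Fin k → Sph d => ∏ j, (f j (ζ j) * ψ s j (ζ j)))
      (Measure.pi fun _ => surf d) := fun s =>
    Integrable.fintype_prod fun j => integrable_mul_continuous (hf j) (hψ s j)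
  have hsplit : ∀ ζ : Fin k → Sph d, (∏ j, f j (ζ j)) * ∑ s, ∏ j, ψ s j (ζ j)
      = ∑ s, ∏ j, (f j (ζ j) * ψ s j (ζ j)) := fun ζ => by
    simp only [Finset.mul_sum, Finset.prod_mul_distrib]
  have key := integral_mul_eq_zero_of_charFun (P := Measure.pi fun _ : Fin k => surf d)
    (Ψ := fun ζ => ∑ s, ∏ j, ψ s j (ζ j)) (integrable_finsetSum _ fun s _ => hint s)
    (measurable_sum_sph d k) (fun ξ => ?_) hG (by
      simp only [hsplit]
      exact integrable_finsetSum _ fun s _ => hfint s)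
  · simp only [hsplit] at key
    rw [integral_finsetSum _ fun s _ => hfint s] at key
    rw [← key]
    exact Finset.sum_congr rfl fun s _ =>
      (integral_fintype_prod_eq_prod (f := fun j a => f j a * ψ s j a)).symm
  · rw [← h0 ξ]
    have hexp : ∀ ζ : Fin k → Sph d, Complex.exp
        ((inner ℝ (∑ j, (ζ j : EuclideanSpace ℝ (Fin d))) ξ : ℝ) * Complex.I)
        = ∏ j, expDot (imagVec ξ) (ζ j) := fun ζ => by
      simp only [expDot_imagVec, sum_inner, Complex.ofReal_sum, Finset.sum_mul, Complex.exp_sum]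
    simp only [hexp, Finset.sum_mul, ← Finset.prod_mul_distrib]
    rw [integral_finsetSum]
    · exact Finset.sum_congr rfl fun s _ =>
        integral_fintype_prod_eq_prod (f := fun j a => ψ s j a * expDot (imagVec ξ) a)
    · exact fun s _ => Integrable.fintype_prod fun j =>
        integrable_mul_continuous (hψi s j) (continuous_expDot _)

theorem exists_expMoment_ne_zero {u : Sph d → ℂ} (hu : Integrable u (surf d))
    (hu0 : ¬ u =ᵐ[surf d] 0) : ∃ z, expMoment u z ≠ 0 := by
  by_contra! h
  exact hu0 (ae_eq_zero_of_expMoment hu fun ξ => h _)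

/-- The factors of a product depending on the sum only are proportional. -/
theorem exists_ae_eq_const_mul {k : ℕ} {f : Fin k → Sph d → ℂ}
    (hf : ∀ j, Integrable (f j) (surf d)) (hf0 : ∀ j, ¬ f j =ᵐ[surf d] 0)
    (hG : AEStronglyMeasurable[MeasurableSpace.comap
        (fun ζ : Fin k → Sph d => ∑ j, (ζ j : EuclideanSpace ℝ (Fin d))) inferInstance]
        (fun ζ : Fin k → Sph d => ∏ j, f j (ζ j)) (Measure.pi fun _ => surf d)) (i j : Fin k) :
    ∃ c : ℂ, c ≠ 0 ∧ f j =ᵐ[surf d] fun a => c * f i a := by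
  rcases eq_or_ne i j with rfl | hij
  · exact ⟨1, one_ne_zero, by simp⟩
  choose w hw using fun r => exists_expMoment_ne_zero (hf r) (hf0 r)
  have hperm : ∀ z : Fin k → Fin d → ℂ, ∏ r, expMoment (f r) (z r)
      = ∏ r, expMoment (f r) (z (Equiv.swap i j r)) := by
    intro z
    -- Exponentials in `ζ_i` and `ζ_j` may be exchanged without changing the push-forward under the
    -- sum. The overall minus sign of the second product is carried by its factor of index `i`.
    have := sum_prod_integral_eq_zero hf hG (S := Bool)
      (fun s r => if s then expDot (z r) else
        fun a => (if r = i then -1 else 1) * expDot (z (Equiv.swap i j r)) a)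
      (by
        intro s r
        cases s
        · simp only [Bool.false_eq_true, if_false]
          fun_prop
        · simp only [if_true]
          fun_prop)
      (by
        intro ξ
        simp only [Fintype.sum_bool, if_true, Bool.false_eq_true, if_false, mul_assoc,
          integral_const_mul, Finset.prod_mul_distrib, Finset.prod_ite_eq', Finset.mem_univ]
        rw [Equiv.prod_comp (Equiv.swap i j)
          (fun r => ∫ a, expDot (z r) a * expDot (imagVec ξ) a ∂(surf d))]
        ring)
    simp only [Fintype.sum_bool, if_true, Bool.false_eq_true, if_false, mul_left_comm (f _ _),
          integral_const_mul, Finset.prod_mul_distrib, Finset.prod_ite_eq', Finset.mem_univ] at this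
    simp only [expMoment]
    linear_combination this
  set ρ : Fin k → (Fin d → ℂ) → ℂ := fun r z => expMoment (f r) z / expMoment (f r) (w r) with hρ
  -- Set every frequency but the `j`-th to a point `w r` where the normalized moment `ρ r` equals
  -- one; only the indices `i` and `j` survive the swap.
  have hrho : ∀ z, ρ j z = ρ j (w i) * ρ i z := by
    intro x
    have h1 := congrArg (· / ∏ r, expMoment (f r) (w r)) (hperm (Function.update w j x))
    simp only [← Finset.prod_div_distrib] at h1
    rw [Finset.prod_eq_single j, Finset.prod_eq_mul i j hij] at h1
    · simp only [Function.update_self, Equiv.swap_apply_left, Equiv.swap_apply_right,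
        Function.update_of_ne hij] at h1
      rw [mul_comm]
      exact h1
    · rintro r - ⟨hri, hrj⟩
      rw [Equiv.swap_apply_of_ne_of_ne hri hrj, Function.update_of_ne hrj, div_self (hw r)]
    · simp
    · simp
    · intro r _ hr
      rw [Function.update_of_ne hr, div_self (hw r)]
    · simp
  set c := expMoment (f j) (w j) * (ρ j (w i) / expMoment (f i) (w i)) with hc
  have hmom : ∀ z, expMoment (f j) z = c * expMoment (f i) z := by
    intro z
    have h1 := hrho z
    have h2 := hw j
    have h3 := hw i
    simp only [hρ] at h1
    rw [div_eq_iff h2] at h1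
    rw [h1, hc]
    simp only [hρ]
    field_simp
  have hae : f j =ᵐ[surf d] fun a => c * f i a := by
    have h1 := ae_eq_zero_of_expMoment (u := fun a => f j a - c * f i a)
      ((hf j).sub ((hf i).const_mul c)) fun ξ => by
        rw [expMoment]
        have e : ∀ a, (f j a - c * f i a) * expDot (imagVec ξ) a
          = f j a * expDot (imagVec ξ) a - c * (f i a * expDot (imagVec ξ) a) := fun a => by ring
        simp only [e]
        rw [integral_sub (integrable_mul_continuous (hf j) (continuous_expDot _))
          ((integrable_mul_continuous (hf i) (continuous_expDot _)).const_mul c),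
          integral_const_mul]
        exact sub_eq_zero.2 (hmom _)
    filter_upwards [h1] with a ha
    exact sub_eq_zero.1 ha
  refine ⟨c, ?_, hae⟩
  intro hc0
  apply hf0 j
  filter_upwards [hae] with a ha
  simp [ha, hc0]

/-- The other factors are tested against fixed exponentials with nonzero moments and cancel;
proportionality replaces `f 1` by `f 0`. -/
theorem sum_integral_mul_integral_eq_zero {n : ℕ} {f : Fin (n + 2) → Sph d → ℂ}
    (hf : ∀ j, Integrable (f j) (surf d)) (hf0 : ∀ j, ¬ f j =ᵐ[surf d] 0)
    (hG : AEStronglyMeasurable[MeasurableSpace.comap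
        (fun ζ : Fin (n + 2) → Sph d => ∑ j, (ζ j : EuclideanSpace ℝ (Fin d))) inferInstance]
        (fun ζ : Fin (n + 2) → Sph d => ∏ j, f j (ζ j)) (Measure.pi fun _ => surf d))
    {S : Type*} [Fintype S] (p q : S → Sph d → ℂ) (hp : ∀ s, Continuous (p s))
    (hq : ∀ s, Continuous (q s))
    (h0 : ∀ ξ, ∑ s, (∫ a, p s a * expDot (imagVec ξ) a ∂(surf d)) *
      (∫ a, q s a * expDot (imagVec ξ) a ∂(surf d)) = 0) :
    ∑ s, (∫ a, f 0 a * p s a ∂(surf d)) * (∫ a, f 0 a * q s a ∂(surf d)) = 0 := by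
  choose c hc hfc using exists_ae_eq_const_mul hf hf0 hG 0
  have hI : ∀ j (φ : Sph d → ℂ), ∫ a, f j a * φ a ∂(surf d) = c j * ∫ a, f 0 a * φ a ∂(surf d) := by
    intro j φ
    rw [← integral_const_mul]
    apply integral_congr_ae
    filter_upwards [hfc j] with a ha
    rw [ha]
    ring
  choose w hw using fun r => exists_expMoment_ne_zero (hf r) (hf0 r)
  have key := sum_prod_integral_eq_zero hf hG
    (fun s => (Fin.cons (p s) (Fin.cons (q s) fun r : Fin n => expDot (w r.succ.succ)) :
      Fin (n + 2) → Sph d → ℂ))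
    (fun s => Fin.cases (hp s) (Fin.cases (hq s) fun r => continuous_expDot _))
    (fun ξ => by
      simp only [Fin.prod_univ_succ, Fin.cons_zero, Fin.cons_succ, ← mul_assoc, ← Finset.sum_mul,
        h0 ξ, zero_mul])
  simp only [Fin.prod_univ_succ, Fin.cons_zero, Fin.cons_succ, ← mul_assoc, ← Finset.sum_mul] at key
  have key2 := (mul_eq_zero.1 key).resolve_right
    (Finset.prod_ne_zero_iff.2 fun r _ => hw r.succ.succ)
  simp only [hI (Fin.succ 0), mul_left_comm _ (c _), ← Finset.mul_sum] at key2
  exact (mul_eq_zero.1 key2).resolve_left (hc _)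

/-- Three-factor analogue of `sum_integral_mul_integral_eq_zero`, needed on the circle. -/
theorem sum_integral_mul_integral_mul_integral_eq_zero {n : ℕ} {f : Fin (n + 3) → Sph d → ℂ}
    (hf : ∀ j, Integrable (f j) (surf d)) (hf0 : ∀ j, ¬ f j =ᵐ[surf d] 0)
    (hG : AEStronglyMeasurable[MeasurableSpace.comap
        (fun ζ : Fin (n + 3) → Sph d => ∑ j, (ζ j : EuclideanSpace ℝ (Fin d))) inferInstance]
        (fun ζ : Fin (n + 3) → Sph d => ∏ j, f j (ζ j)) (Measure.pi fun _ => surf d))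
    {S : Type*} [Fintype S] (p q r : S → Sph d → ℂ) (hp : ∀ s, Continuous (p s))
    (hq : ∀ s, Continuous (q s)) (hr : ∀ s, Continuous (r s))
    (h0 : ∀ ξ, ∑ s, (∫ a, p s a * expDot (imagVec ξ) a ∂(surf d)) *
      (∫ a, q s a * expDot (imagVec ξ) a ∂(surf d)) *
      (∫ a, r s a * expDot (imagVec ξ) a ∂(surf d)) = 0) :
    ∑ s, (∫ a, f 0 a * p s a ∂(surf d)) * (∫ a, f 0 a * q s a ∂(surf d)) *
      (∫ a, f 0 a * r s a ∂(surf d)) = 0 := by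
  choose c hc hfc using exists_ae_eq_const_mul hf hf0 hG 0
  have hI : ∀ j (φ : Sph d → ℂ), ∫ a, f j a * φ a ∂(surf d) = c j * ∫ a, f 0 a * φ a ∂(surf d) := by
    intro j φ
    rw [← integral_const_mul]
    apply integral_congr_ae
    filter_upwards [hfc j] with a ha
    rw [ha]
    ring
  choose w hw using fun r => exists_expMoment_ne_zero (hf r) (hf0 r)
  have key := sum_prod_integral_eq_zero hf hG
    (fun s => (Fin.cons (p s) (Fin.cons (q s) (Fin.cons (r s)
      fun i : Fin n => expDot (w i.succ.succ.succ))) : Fin (n + 3) → Sph d → ℂ))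
    (fun s => Fin.cases (hp s) (Fin.cases (hq s) (Fin.cases (hr s) fun r => continuous_expDot _)))
    (fun ξ => by
      simp only [Fin.prod_univ_succ, Fin.cons_zero, Fin.cons_succ, ← mul_assoc, ← Finset.sum_mul,
        h0 ξ, zero_mul])
  simp only [Fin.prod_univ_succ, Fin.cons_zero, Fin.cons_succ, ← mul_assoc, ← Finset.sum_mul] at key
  have key2 := (mul_eq_zero.1 key).resolve_right
    (Finset.prod_ne_zero_iff.2 fun r _ => hw r.succ.succ.succ)
  simp only [hI (Fin.succ 0), hI (Fin.succ (Fin.succ 0))] at key2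
  have key3 : c (Fin.succ 0) * c (Fin.succ (Fin.succ 0)) *
      ∑ s, (∫ a, f 0 a * p s a ∂(surf d)) * (∫ a, f 0 a * q s a ∂(surf d)) *
      (∫ a, f 0 a * r s a ∂(surf d)) = 0 := by
    rw [← key2, Finset.mul_sum]
    exact Finset.sum_congr rfl fun s _ => by ring
  exact (mul_eq_zero.1 key3).resolve_left (mul_ne_zero (hc _) (hc _))

theorem integral_coord_mul_expDot_mul_expDot (i : Fin d) (z w : Fin d → ℂ) :
    ∫ a, coord i a * expDot z a * expDot w a ∂(surf d)
      = coordMoment (fun _ : Sph d => 1) (z + w) i := by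
  simp only [coordMoment, expDot_add, one_mul, mul_assoc]

theorem integral_mul_angular {u : Sph d → ℂ} (hu : Integrable u (surf d)) (z : Fin d → ℂ)
    (j l : Fin d) :
    ∫ a, u a * ((z l * coord j a - z j * coord l a) * expDot z a) ∂(surf d)
      = z l * coordMoment u z j - z j * coordMoment u z l := by
  simp only [coordMoment]
  rw [← integral_const_mul, ← integral_const_mul, ← integral_sub]
  · congr 1
    ext a
    ring
  · exact (integrable_mul_continuous hu (by fun_prop)).const_mul _
  · exact (integrable_mul_continuous hu (by fun_prop)).const_mul _

/-- The frequency shifts to `z + w` but the coefficients remain those of `z`. By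
`coordMoment_one_rotation` at `z + w`, they can be traded for `-w`, which with `w = iξ` no longer
depends on `z`. -/
theorem integral_angular_mul_expDot (z w : Fin d → ℂ) (j l : Fin d) :
    ∫ a, (z l * coord j a - z j * coord l a) * expDot z a * expDot w a ∂(surf d)
      = z l * coordMoment (fun _ : Sph d => 1) (z + w) j
        - z j * coordMoment (fun _ : Sph d => 1) (z + w) l := by
  simp only [coordMoment]
  have i1 : ∀ r : Fin d, Integrable (fun a : Sph d => (1 : ℂ) * (coord r a * expDot (z + w) a))
      (surf d) := fun r => integrable_mul_continuous (integrable_const 1) (by fun_prop)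
  rw [← integral_const_mul, ← integral_const_mul, ← integral_sub ((i1 j).const_mul _)
    ((i1 l).const_mul _)]
  congr 1
  ext a
  rw [expDot_add]
  ring

/-! ### Quadratic and cubic identities for the moments of `f 0` -/

/-- The bilinear identity expressing that the rotations about `a + b` preserve `u(a) u(b)`. -/
theorem coordMoment_bilinear {n : ℕ} {f : Fin (n + 2) → Sph d → ℂ}
    (hf : ∀ j, Integrable (f j) (surf d)) (hf0 : ∀ j, ¬ f j =ᵐ[surf d] 0)
    (hG : AEStronglyMeasurable[MeasurableSpace.comap
        (fun ζ : Fin (n + 2) → Sph d => ∑ j, (ζ j : EuclideanSpace ℝ (Fin d))) inferInstance]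
        (fun ζ : Fin (n + 2) → Sph d => ∏ j, f j (ζ j)) (Measure.pi fun _ => surf d))
    (z w : Fin d → ℂ) (i j l : Fin d) :
    let M := coordMoment (f 0)
    let N := fun z j l => z l * M z j - z j * M z l
    N z j l * M w i + N z l i * M w j + N z i j * M w l
      + (M z i * N w j l + M z j * N w l i + M z l * N w i j) = 0 := by
  intro M N
  have key := sum_integral_mul_integral_eq_zero hf hf0 hG (S := Fin 6)
    ![fun a => (z l * coord j a - z j * coord l a) * expDot z a,
      fun a => (z i * coord l a - z l * coord i a) * expDot z a,
      fun a => (z j * coord i a - z i * coord j a) * expDot z a,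
      fun a => coord i a * expDot z a, fun a => coord j a * expDot z a,
      fun a => coord l a * expDot z a]
    ![fun a => coord i a * expDot w a, fun a => coord j a * expDot w a,
      fun a => coord l a * expDot w a,
      fun a => (w l * coord j a - w j * coord l a) * expDot w a,
      fun a => (w i * coord l a - w l * coord i a) * expDot w a,
      fun a => (w j * coord i a - w i * coord j a) * expDot w a]
    (by intro s; fin_cases s <;> simp <;> fun_prop)
    (by intro s; fin_cases s <;> simp <;> fun_prop)
    (by
      intro ξ
      simp only [Fin.sum_univ_six, Matrix.cons_val]
      simp only [integral_coord_mul_expDot_mul_expDot, integral_angular_mul_expDot]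
      have hz := coordMoment_one_rotation (z + imagVec ξ)
      have hw := coordMoment_one_rotation (w + imagVec ξ)
      simp only [Pi.add_apply] at hz hw
      set A := coordMoment (fun _ : Sph d => 1) (z + imagVec ξ)
      set B := coordMoment (fun _ : Sph d => 1) (w + imagVec ξ)
      -- After the trade of coefficients, the two cyclic sums are, up to a common factor, the 3×3
      -- determinants of `(B, ξ, A)` and `(A, ξ, B)` in the indices `i, j, l`; they cancel.
      linear_combination B i * hz j l + B j * hz l i + B l * hz i j
        + A i * hw j l + A j * hw l i + A l * hw i j)
  simp only [Fin.sum_univ_six, Matrix.cons_val, integral_mul_angular (hf 0)] at key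
  simp only [M, N]
  simp only [coordMoment] at key ⊢
  linear_combination key

/-- The trilinear identity expressing that, on the circle, `u(a) u(b) u(c)` is constant along the
curves on which `a + b + c` is. -/
theorem coordMoment_trilinear {n : ℕ} {f : Fin (n + 3) → Sph d → ℂ}
    (hf : ∀ j, Integrable (f j) (surf d)) (hf0 : ∀ j, ¬ f j =ᵐ[surf d] 0)
    (hG : AEStronglyMeasurable[MeasurableSpace.comap
        (fun ζ : Fin (n + 3) → Sph d => ∑ j, (ζ j : EuclideanSpace ℝ (Fin d))) inferInstance]
        (fun ζ : Fin (n + 3) → Sph d => ∏ j, f j (ζ j)) (Measure.pi fun _ => surf d))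
    (z w v : Fin d → ℂ) (j l : Fin d) :
    let M := coordMoment (f 0)
    let N := fun z => z l * M z j - z j * M z l
    N z * (M w j * M v l - M w l * M v j) + N w * (M v j * M z l - M v l * M z j)
      + N v * (M z j * M w l - M z l * M w j) = 0 := by
  intro M N
  have key := sum_integral_mul_integral_mul_integral_eq_zero hf hf0 hG (S := Fin 6)
    -- Each term of the identity is an angular factor times a 2×2 determinant; the six entries are
    -- the expanded determinants, with the signs put in the first family.
    ![fun a => (z l * coord j a - z j * coord l a) * expDot z a,
      fun a => -(z l * coord j a - z j * coord l a) * expDot z a,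
      fun a => coord l a * expDot z a, fun a => -coord j a * expDot z a,
      fun a => coord j a * expDot z a, fun a => -coord l a * expDot z a]
    ![fun a => coord j a * expDot w a, fun a => coord l a * expDot w a,
      fun a => (w l * coord j a - w j * coord l a) * expDot w a,
      fun a => (w l * coord j a - w j * coord l a) * expDot w a,
      fun a => coord l a * expDot w a, fun a => coord j a * expDot w a]
    ![fun a => coord l a * expDot v a, fun a => coord j a * expDot v a,
      fun a => coord j a * expDot v a, fun a => coord l a * expDot v a,
      fun a => (v l * coord j a - v j * coord l a) * expDot v a,
      fun a => (v l * coord j a - v j * coord l a) * expDot v a]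
    (by intro s; fin_cases s <;> simp <;> fun_prop)
    (by intro s; fin_cases s <;> simp <;> fun_prop)
    (by intro s; fin_cases s <;> simp <;> fun_prop)
    (by
      intro ξ
      simp only [Fin.sum_univ_six, Matrix.cons_val, neg_mul, integral_neg]
      simp only [integral_coord_mul_expDot_mul_expDot, integral_angular_mul_expDot]
      have hz := coordMoment_one_rotation (z + imagVec ξ) j l
      have hw := coordMoment_one_rotation (w + imagVec ξ) j l
      have hv := coordMoment_one_rotation (v + imagVec ξ) j l
      simp only [Pi.add_apply] at hz hw hv
      set A := coordMoment (fun _ : Sph d => 1) (z + imagVec ξ)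
      set B := coordMoment (fun _ : Sph d => 1) (w + imagVec ξ)
      set C := coordMoment (fun _ : Sph d => 1) (v + imagVec ξ)
      -- What remains is the Plücker relation `[ξ,A][B,C] + [ξ,B][C,A] + [ξ,C][A,B] = 0` in the
      -- plane of the indices `j, l`.
      linear_combination (B j * C l - B l * C j) * hz + (C j * A l - C l * A j) * hw
        + (A j * B l - A l * B j) * hv)
  simp only [Fin.sum_univ_six, Matrix.cons_val, neg_mul, mul_neg, integral_neg,
    integral_mul_angular (hf 0)] at key
  simp only [M, N]
  simp only [coordMoment] at key ⊢
  linear_combination key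

/-! ### The moments span `ℂ^d` -/

theorem surf_inner_eq_zero_null {v : EuclideanSpace ℝ (Fin d)} (hv : v ≠ 0) :
    surf d {a | inner ℝ v (a : EuclideanSpace ℝ (Fin d)) = 0} = 0 := by
  have hms : MeasurableSet {a : Sph d | inner ℝ v (a : EuclideanSpace ℝ (Fin d)) = 0} := by
    have : Measurable fun a : Sph d => inner ℝ v (a : EuclideanSpace ℝ (Fin d)) := by fun_prop
    exact this (measurableSet_singleton 0)
  rw [Measure.toSphere_apply' _ hms]
  refine mul_eq_zero_of_right _ ?_
  refine measure_mono_null (t := ((Submodule.span ℝ {v})ᗮ : Set (EuclideanSpace ℝ (Fin d)))) ?_ ?_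
  · rintro _ ⟨t, _, _, ⟨a, ha, rfl⟩, rfl⟩
    rw [SetLike.mem_coe, Submodule.mem_orthogonal_singleton_iff_inner_right]
    simp only [inner_smul_right]
    rw [show inner ℝ v (a : EuclideanSpace ℝ (Fin d)) = 0 from ha, mul_zero]
  · apply Measure.addHaar_submodule
    intro h
    have : v ∈ (Submodule.span ℝ {v})ᗮ := by rw [h]; trivial
    rw [Submodule.mem_orthogonal_singleton_iff_inner_right] at this
    exact hv (inner_self_eq_zero.1 this)

/-- A nonzero complex linear form vanishes almost nowhere on the sphere. -/
theorem ae_sum_mul_coord_ne_zero {α : Fin d → ℂ} (hα : α ≠ 0) :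
    ∀ᵐ a ∂(surf d), ∑ i, α i * coord i a ≠ 0 := by
  obtain ⟨i, hi⟩ := Function.ne_iff.1 hα
  -- `L` will be the real or the imaginary part, whichever is nonzero at `α i`; the complex form
  -- then vanishes only where a nonzero real form does.
  have main : ∀ L : ℂ →ₗ[ℝ] ℝ, L (α i) ≠ 0 → ∀ᵐ a ∂(surf d), ∑ i, α i * coord i a ≠ 0 := by
    intro L hL
    set v : EuclideanSpace ℝ (Fin d) := WithLp.toLp 2 fun r => L (α r) with hv
    have hv0 : v ≠ 0 := fun h => hL (by simpa [hv] using congrArg (fun x => x i) h)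
    rw [ae_iff]
    refine measure_mono_null ?_ (surf_inner_eq_zero_null hv0)
    intro a ha
    simp only [ne_eq, not_not, Set.mem_ofPred_eq] at ha ⊢
    have h1 := congrArg L ha
    rw [map_sum, map_zero] at h1
    rw [PiLp.inner_apply, ← h1]
    refine Finset.sum_congr rfl fun r _ => ?_
    rw [coord, mul_comm (α r), ← Complex.real_smul, map_smul]
    simp [hv]
  by_cases h : (α i).re = 0
  · refine main Complex.imLm fun h' => hi (Complex.ext h h')
  · exact main Complex.reLm h

/-- The coordinate moments of a nonzero function span `ℂ^d`. -/
theorem surjective_linearCombination_coordMoment {u : Sph d → ℂ} (hu : Integrable u (surf d))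
    (hu0 : ¬ u =ᵐ[surf d] 0) :
    Function.Surjective (Finsupp.linearCombination ℂ (coordMoment u)) := by
  rw [← LinearMap.range_eq_top]
  by_contra hne
  obtain ⟨φ, hφ0, hφ⟩ := Submodule.exists_le_ker_of_lt_top _ (lt_top_iff_ne_top.2 hne)
  set α : Fin d → ℂ := fun i => φ (Pi.single i 1) with hα
  have hφα : ∀ x : Fin d → ℂ, φ x = ∑ i, α i * x i := by
    intro x
    conv_lhs => rw [← Finset.univ_sum_single x]
    rw [map_sum]
    refine Finset.sum_congr rfl fun i _ => ?_
    rw [hα, mul_comm, ← smul_eq_mul, ← map_smul, ← Pi.single_smul, smul_eq_mul, mul_one]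
  have hα0 : α ≠ 0 := by
    intro h
    apply hφ0
    ext i
    simpa [hα] using congrFun h i
  have hM : ∀ z, ∑ i, α i * coordMoment u z i = 0 := by
    intro z
    rw [← hφα]
    exact hφ ⟨Finsupp.single z 1, by simp⟩
  have hint : Integrable (fun a => u a * ∑ i, α i * coord i a) (surf d) :=
    integrable_mul_continuous hu (by fun_prop)
  -- A linear form `α` killing all moments means that `u(a) (α · a)` has zero transform, while `α ·
  -- a` is almost everywhere nonzero.
  have hz := ae_eq_zero_of_expMoment hint fun ξ => by
    rw [← hM (imagVec ξ)]
    simp only [expMoment, coordMoment, ← integral_const_mul]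
    rw [← integral_finsetSum]
    · congr 1
      ext a
      rw [Finset.mul_sum, Finset.sum_mul]
      exact Finset.sum_congr rfl fun i _ => by ring
    · exact fun i _ => (integrable_mul_continuous hu (by fun_prop)).const_mul _
  apply hu0
  filter_upwards [hz, ae_sum_mul_coord_ne_zero hα0] with a h1 h2
  exact (mul_eq_zero.1 h1).resolve_right h2

/-! ### Linear algebra: recovering `κ` -/

section LinearAlgebra

variable {W : Type*} [AddCommGroup W] [Module ℂ W]

/-- Solution of the bilinear identity in dimension at least three. -/
theorem exists_angular_eq_of_bilinear (hd : 3 ≤ d) (m : W →ₗ[ℂ] (Fin d → ℂ))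
    (hm : Function.Surjective m) (n : Fin d → Fin d → W →ₗ[ℂ] ℂ)
    (hn : ∀ j l p, n j l p = -n l j p)
    (h : ∀ p q i j l, n j l p * m q i + n l i p * m q j + n i j p * m q l
      + (m p i * n j l q + m p j * n l i q + m p l * n i j q) = 0) :
    ∃ κ : Fin d → ℂ, ∀ p j l, n j l p = κ l * m p j - κ j * m p l := by
  choose q hq using fun t : Fin d => hm (Pi.single t 1)
  have hqe : ∀ i, m (q i) i = 1 := fun i => by simp [hq]
  have hqn : ∀ i j, j ≠ i → m (q i) j = 0 := fun i j hij => by simp [hq, hij]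
  -- With `m (q i) = e_i`, evaluating at `p = q = q i` leaves twice `n j l (q i)`. Evaluating only
  -- the second argument at `q i` then gives the formula for indices other than `i`, with candidate
  -- `κ_l = n i l (q i)`, and `hcons` shows that it does not depend on `i`.
  have hzero : ∀ i j l, j ≠ i → l ≠ i → n j l (q i) = 0 := by
    intro i j l hj hl
    have := h (q i) (q i) i j l
    rw [hqe, hqn i j hj, hqn i l hl] at this
    linear_combination this / 2
  have hrel : ∀ i j l p, j ≠ i → l ≠ i → n j l p = n i l (q i) * m p j - n i j (q i) * m p l := by
    intro i j l p hj hl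
    have h1 := h p (q i) i j l
    rw [hqe, hqn i j hj, hqn i l hl, hzero i j l hj hl] at h1
    linear_combination h1 - m p j * hn l i (q i)
  have hcons : ∀ i j l, j ≠ i → l ≠ i → l ≠ j → n j l (q j) = n i l (q i) := by
    intro i j l hj hl hlj
    rw [hrel i j l (q j) hj hl, hqe, hqn j l hlj]
    ring
  -- Dimension at least three enters here: an index must avoid both `j` and `l`.
  have hex : ∀ j l : Fin d, ∃ i, j ≠ i ∧ l ≠ i := by
    intro j l
    obtain ⟨i, -, hi⟩ := Finset.exists_mem_notMem_of_card_lt_card (s := {j, l})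
      (t := (Finset.univ : Finset (Fin d))) (by
        rw [Finset.card_univ, Fintype.card_fin]
        exact lt_of_le_of_lt Finset.card_le_two (by omega))
    simp only [Finset.mem_insert, Finset.mem_singleton, not_or] at hi
    exact ⟨i, Ne.symm hi.1, Ne.symm hi.2⟩
  choose g hg using fun l => hex l l
  have hκ : ∀ i l, l ≠ i → n i l (q i) = n (g l) l (q (g l)) := by
    intro i l hl
    by_cases hi : i = g l
    · rw [← hi]
    · exact hcons (g l) i l hi (hg l).1 hl
  refine ⟨fun l => n (g l) l (q (g l)), fun p j l => ?_⟩
  obtain ⟨i, hj, hl⟩ := hex j l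
  rw [hrel i j l p hj hl, hκ i l hl, hκ i j hj]

/-- Solution of the trilinear identity in dimension two. -/
theorem exists_angular_eq_of_trilinear (m : W →ₗ[ℂ] (Fin 2 → ℂ))
    (hm : Function.Surjective m) (n : W →ₗ[ℂ] ℂ)
    (h : ∀ p q r, n p * (m q 0 * m r 1 - m q 1 * m r 0) + n q * (m r 0 * m p 1 - m r 1 * m p 0)
      + n r * (m p 0 * m q 1 - m p 1 * m q 0) = 0) :
    ∃ κ : Fin 2 → ℂ, ∀ p, n p = κ 1 * m p 0 - κ 0 * m p 1 := by
  obtain ⟨q, hq⟩ := hm ![1, 0]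
  obtain ⟨r, hr⟩ := hm ![0, 1]
  refine ⟨![-n r, n q], fun p => ?_⟩
  have := h p q r
  simp [hq, hr] at this ⊢
  linear_combination this

end LinearAlgebra

/-! ### Solution of the functional equation -/

/-- A function whose angular moments are those of an exponential is an exponential. -/
theorem ae_eq_const_mul_expDot_of_angular {u : Sph d → ℂ} (hd : 2 ≤ d) (hu : Integrable u (surf d))
    {κ : Fin d → ℂ} (h : ∀ z j l, z l * coordMoment u z j - z j * coordMoment u z l
      = κ l * coordMoment u z j - κ j * coordMoment u z l) :
    ∃ c : ℂ, ∀ᵐ a ∂(surf d), u a = c * expDot (-κ) a := by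
  have hmom : ∀ z i, coordMoment (fun a => u a * expDot κ a) z i = coordMoment u (z + κ) i := by
    intro z i
    simp only [coordMoment, expDot_add]
    congr 1
    ext a
    ring
  -- Multiplying by `e^{κ·a}` shifts the frequency by `κ`, which absorbs the right-hand side and
  -- leaves exact rotational symmetry.
  obtain ⟨c, hc⟩ := ae_eq_const_of_rotation (g := fun a => u a * expDot κ a)
    (integrable_mul_continuous hu (continuous_expDot κ)) hd (by
      intro z j l
      have := h (z + κ) j l
      simp only [Pi.add_apply] at this
      rw [hmom, hmom]
      linear_combination this)
  refine ⟨c, ?_⟩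
  filter_upwards [hc] with a ha
  rw [← ha, mul_assoc, ← expDot_add, add_neg_cancel, expDot_zero, mul_one]

/-- The functional equation `∏ f_j(ζ_j) = h(ζ_1 + ⋯ + ζ_k)` on the sphere. -/
theorem exists_ae_eq_const_mul_expDot {k : ℕ} (hd : 2 ≤ d) (hk : 2 ≤ k) (hdk : (d, k) ≠ (2, 2))
    {f : Fin k → Sph d → ℂ}
    (hf : ∀ j, Integrable (f j) (surf d)) (hf0 : ∀ j, ¬ f j =ᵐ[surf d] 0)
    (hG : AEStronglyMeasurable[MeasurableSpace.comap
        (fun ζ : Fin k → Sph d => ∑ j, (ζ j : EuclideanSpace ℝ (Fin d))) inferInstance]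
        (fun ζ : Fin k → Sph d => ∏ j, f j (ζ j)) (Measure.pi fun _ => surf d)) :
    ∃ (c : Fin k → ℂ) (ν : Fin d → ℂ), (∀ j, c j ≠ 0) ∧
      ∀ j, ∀ᵐ a ∂(surf d), f j a = c j * expDot ν a := by
  obtain ⟨n, rfl⟩ : ∃ n, k = n + 2 := ⟨k - 2, by omega⟩
  have hκ : ∃ κ : Fin d → ℂ, ∀ z j l, z l * coordMoment (f 0) z j - z j * coordMoment (f 0) z l
      = κ l * coordMoment (f 0) z j - κ j * coordMoment (f 0) z l := by
    have hsurj := surjective_linearCombination_coordMoment (hf 0) (hf0 0)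
    set M := coordMoment (f 0) with hM
    rcases Nat.lt_or_ge 2 d with hd3 | hd2
    · obtain ⟨κ, hκ⟩ := exists_angular_eq_of_bilinear hd3 _ hsurj
        (fun j l => Finsupp.linearCombination ℂ fun z : Fin d → ℂ => z l * M z j - z j * M z l)
        (by
          intro j l p
          rw [← LinearMap.neg_apply]
          congr 1
          ext z
          simp)
        (by
          intro p q i j l
          -- Finitely supported combinations of frequencies make the identity bilinear in `p` and
          -- `q`, so it suffices to check it at single frequencies.
          induction p using Finsupp.induction_linear with
          | zero => simp
          | add p p' hp hp' =>
            simp only [map_add, Pi.add_apply]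
            linear_combination hp + hp'
          | single z x =>
            induction q using Finsupp.induction_linear with
            | zero => simp
            | add q q' hq hq' =>
              simp only [map_add, Pi.add_apply]
              linear_combination hq + hq'
            | single w y =>
              have := coordMoment_bilinear hf hf0 hG z w i j l
              simp only [Finsupp.linearCombination_single, Pi.smul_apply, smul_eq_mul]
              linear_combination x * y * this)
      refine ⟨κ, fun z j l => ?_⟩
      simpa using hκ (Finsupp.single z 1) j l
    · obtain rfl : d = 2 := le_antisymm hd2 hd
      -- On the circle the argument needs a third factor; excluding `(d, k) = (2, 2)` provides it.
      obtain ⟨n, rfl⟩ : ∃ n', n = n' + 1 := by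
        refine ⟨n - 1, ?_⟩
        rcases n with _ | n
        · exact absurd rfl hdk
        · simp
      obtain ⟨κ, hκ⟩ := exists_angular_eq_of_trilinear _ hsurj
        (Finsupp.linearCombination ℂ fun z : Fin 2 → ℂ => z 1 * M z 0 - z 0 * M z 1)
        (by
          intro p q r
          induction p using Finsupp.induction_linear with
          | zero => simp
          | add p p' hp hp' =>
            simp only [map_add, Pi.add_apply]
            linear_combination hp + hp'
          | single z x =>
            induction q using Finsupp.induction_linear with
            | zero => simp
            | add q q' hq hq' =>
              simp only [map_add, Pi.add_apply]
              linear_combination hq + hq'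
            | single w y =>
              induction r using Finsupp.induction_linear with
              | zero => simp
              | add r r' hr hr' =>
                simp only [map_add, Pi.add_apply]
                linear_combination hr + hr'
              | single v t =>
                have := coordMoment_trilinear hf hf0 hG z w v 0 1
                simp only [Finsupp.linearCombination_single, Pi.smul_apply, smul_eq_mul]
                linear_combination x * y * t * this)
      refine ⟨κ, fun z j l => ?_⟩
      have h01 : z 1 * M z 0 - z 0 * M z 1 = κ 1 * M z 0 - κ 0 * M z 1 := by
        simpa using hκ (Finsupp.single z 1)
      fin_cases j <;> fin_cases l
      · simp
      · exact h01
      · simp only [Fin.mk_one, Fin.zero_eta]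
        linear_combination -h01
      · simp
  obtain ⟨κ, hκ⟩ := hκ
  obtain ⟨c, hc⟩ := ae_eq_const_mul_expDot_of_angular hd (hf 0) hκ
  choose b hb hfb using exists_ae_eq_const_mul hf hf0 hG 0
  have hc0 : c ≠ 0 := by
    rintro rfl
    apply hf0 0
    filter_upwards [hc] with a ha
    simp [ha]
  refine ⟨fun j => b j * c, -κ, fun j => mul_ne_zero (hb j) hc0, fun j => ?_⟩
  filter_upwards [hfb j, hc] with a h1 h2
  rw [h1, h2, mul_assoc]

/-- With a common `ν`, the exponentials multiply to `e^{ν·(ζ_1 + ⋯ + ζ_k)}`, a function of the sum;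
coordinate projections pull null sets back to null sets. -/
theorem aestronglyMeasurable_prod_of_ae_eq_expDot {k : ℕ} {f : Fin k → Sph d → ℂ}
    {c : Fin k → ℂ} {ν : Fin d → ℂ} (h : ∀ j, ∀ᵐ a ∂(surf d), f j a = c j * expDot ν a) :
    AEStronglyMeasurable[MeasurableSpace.comap
        (fun ζ : Fin k → Sph d => ∑ j, (ζ j : EuclideanSpace ℝ (Fin d))) inferInstance]
        (fun ζ : Fin k → Sph d => ∏ j, f j (ζ j)) (Measure.pi fun _ => surf d) := by
  set φ : EuclideanSpace ℝ (Fin d) → ℂ :=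
    fun x => (∏ j, c j) * Complex.exp (∑ i, ν i * (x i : ℂ)) with hφ
  have hφm : Measurable φ := by
    have : Continuous φ := by fun_prop
    exact this.measurable
  have h1 : AEStronglyMeasurable[MeasurableSpace.comap
        (fun ζ : Fin k → Sph d => ∑ j, (ζ j : EuclideanSpace ℝ (Fin d))) inferInstance]
        (fun ζ : Fin k → Sph d => φ (∑ j, (ζ j : EuclideanSpace ℝ (Fin d))))
        (Measure.pi fun _ => surf d) :=
    (hφm.comp (comap_measurable _)).stronglyMeasurable.aestronglyMeasurable
  refine h1.congr ?_
  have h2 : ∀ᵐ ζ : Fin k → Sph d ∂(Measure.pi fun _ => surf d),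
      ∀ j, f j (ζ j) = c j * expDot ν (ζ j) := by
    rw [ae_all_iff]
    exact fun j => (Measure.quasiMeasurePreserving_eval (fun _ : Fin k => surf d) j).ae (h j)
  filter_upwards [h2] with ζ hζ
  simp only [hζ, Finset.prod_mul_distrib, hφ]
  congr 1
  simp only [expDot, ← Complex.exp_sum]
  congr 1
  rw [Finset.sum_comm]
  refine Finset.sum_congr rfl fun i _ => ?_
  simp [Finset.mul_sum]

end SphereRestriction

end

theorem theorem2 (d k : ℕ) (hd : 2 ≤ d) (hk : 2 ≤ k)
    (f : Fin k → SphereRestriction.Sph d → ℂ)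
    (hf : ∀ j, MeasureTheory.Integrable (f j) (SphereRestriction.surf d))
    (hf0 : ∀ j, ¬ f j =ᵐ[SphereRestriction.surf d] 0) :
    SphereRestriction.prodNormSq f ≤ SphereRestriction.weightedIntegral f ∧
    ((d, k) ≠ (2, 2) → SphereRestriction.weightedIntegral f ≠ ⊤ →
      (SphereRestriction.prodNormSq f = SphereRestriction.weightedIntegral f ↔
        ∃ (c : Fin k → ℂ) (ν : Fin d → ℂ), (∀ j, c j ≠ 0) ∧
          ∀ j, ∀ᵐ ζ ∂(SphereRestriction.surf d),
            f j ζ = c j * Complex.exp (∑ i, ν i * ((ζ : EuclideanSpace ℝ (Fin d)) i : ℂ)))) := by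
  refine ⟨?_, fun hdk hW => ?_⟩
  · by_cases hW : SphereRestriction.weightedIntegral f = ⊤
    · rw [hW]
      exact le_top
    · exact (SphereRestriction.prodNormSq_le_and_eq_iff hd hk hf hW).1
  · rw [(SphereRestriction.prodNormSq_le_and_eq_iff hd hk hf hW).2]
    refine ⟨fun h => SphereRestriction.exists_ae_eq_const_mul_expDot hd hk hdk hf hf0 h, ?_⟩
    rintro ⟨c, ν, -, h⟩
    exact SphereRestriction.aestronglyMeasurable_prod_of_ae_eq_expDot h
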